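/- Let $M$ be a smooth manifold (finite-dimensional, Hausdorff, second countable), let $E\to M$ be a smooth complex vector bundle of finite rank $k\ge 1$ with a Hermitian fibre metric $h_0$, and let $\mathcal A=C^\infty(M)$ (complex-valued smooth functions, with complex conjugation) and $\mathcal B=\Gamma^\infty(\mathrm{End}(E))$, with the involution given by fibrewise $h_0$-adjoints. *Deformations.* For $\mathcal C=\mathcal A$ or $\mathcal B$, a local Hermitian deformation of $\mathcal C$ is an associative $\mathbb C[[\lambda]]$-bilinear product $\star$ on $\mathcal C[[\lambda]]$ such that $a\star b=\sum_{r\ge0}C_r(a,b)\lambda^r$ for $a,b\in\mathcal C$, where $C_0$ is the original product and each $C_r$ is local ($\operatorname{supp}C_r(a,b)\subseteq \operatorname{supp}a\cap\operatorname{supp}b$), such that $1\in\mathcal C$ is the unit of $\star$, and such that the coefficientwise involution (with $\lambda^*=\lambda$) satisfies $(a\star b)^*=b^*\star a^*$. Two of them are equivalent, $\star_1\sim\star_2$, if there is $T=\mathrm{id}+\sum_{r\ge1}T_r\lambda^r$, with local $\mathbb C$-linear maps $T_r:\mathcal C\to\mathcal C$ and $T(a^*)=T(a)^*$, such that $T(a\star_1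 b)=T(a)\star_2T(b)$. Let $\mathrm{Def}^*(\mathcal C)$ be the set of equivalence classes $[\star]$. *The map $\Phi:\mathrm{Def}^*(\mathcal A)\to\mathrm{Def}^*(\mathcal B)$.* Identify $(\Gamma^\infty(E),h_0)$ isometrically, as an inner product $\mathcal A$-module, with $P_0\mathcal A^n$ for a projection $P_0=P_0^*=P_0^2\in M_n(\mathcal A)$, where $P_0\mathcal A^n$ has the inner product $\sum_i x_i^*y_i$; then $\mathcal B=P_0M_n(\mathcal A)P_0$. Given $\star$, put $\mathbf A=(\mathcal A[[\lambda]],\star)$ and choose a projection $\mathbf P\in M_n(\mathbf A)$ with $\mathbf P=P_0+O(\lambda)$. The map $I:\mathcal B[[\lambda]]\to\mathbf P\star M_n(\mathbf A)\star\mathbf P$, $I(L)=\mathbf P\star L\star\mathbf P$, is bijective. Then $[\star']=\Phi([\star])$ means that $\star'$ is equivalent, through some $T$ of the above form, to the product obtained on $\mathcal B[[\lambda]]$ by pulling back along $I$, that is, $I(T(a\star' b))=I(T(a))\star I(T(b))$ for all $a,b\in\mathcal B[[\lambda]]$. The class $[\star']$ does not depend on the choices. *Formal Morita equivalence.* $\mathbb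 R[[\lambda]]$ is ordered by the sign of the first nonvanishing coefficient, and $z\ge0$ in $\mathbb C[[\lambda]]$ means that $z$ is a real series with $z\ge0$. For a $^*$-algebra $\mathbf C$ over $\mathbb C[[\lambda]]$, a linear functional $\omega$ is positive if $\omega(c^*c)\ge0$ for all $c$, and an element $c$ is positive if $\omega(c)\ge0$ for every positive $\omega$. Unital $^*$-algebras $\mathbf A,\mathbf B$ over $\mathbb C[[\lambda]]$ are formally Morita equivalent if there is a $(\mathbf B$-$\mathbf A)$-bimodule $\mathbf E$ (over $\mathbb C[[\lambda]]$) with Hermitian, positive semi-definite ($\langle x,x\rangle$ and $\Theta_{x,x}$ are positive elements), full (the values span the algebra) inner products, $\langle\cdot,\cdot\rangle$ with values in $\mathbf A$ and right $\mathbf A$-linear in the second argument, and $\Theta_{\cdot,\cdot}$ with values in $\mathbf B$ and left $\mathbf B$-linear in the first argument, such that $\langle x,by\rangle=\langle b^*x,y\rangle$, $\Theta_{x,ya}=\Theta_{xa^*,y}$, $\Theta_{x,y}z=x\langle y,z\rangle$, and such that (P) for every $^*$-representation $\pi$ of $\mathbf A$ on a pre-Hilbert space over $\mathbb C[[\lambda]]$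 and all finite families $x_i\in\mathbf E$ and vectors $\psi_i$, $\sum_{i,j}\langle\psi_i,\pi(\langle x_i,x_j\rangle)\psi_j\rangle\ge0$; (Q) the same holds for the $^*$-representations of $\mathbf B$ and $\Theta$ in place of $\langle\cdot,\cdot\rangle$. **Corollary.** Let $\star$ and $\star'$ be local Hermitian deformations of $\mathcal A=C^\infty(M)$ and $\mathcal B=\Gamma^\infty(\mathrm{End}(E))$ with $[\star']=\Phi([\star])$. Then the $^*$-algebras $\mathbf A=(C^\infty(M)[[\lambda]],\star)$ and $\mathbf B=(\Gamma^\infty(\mathrm{End}(E))[[\lambda]],\star')$ over $\mathbb C[[\lambda]]$ are formally Morita equivalent. -/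

import Mathlib

open scoped Manifold ContDiff PowerSeries

noncomputable section

/-! ## Formal power series -/

/-- `FormalSeries W` is `W[[λ]]`: the element `a` stands for `∑ r, (a r) λ^r`. -/
def FormalSeries (W : Type*) : Type _ := ℕ → W

namespace FormalSeries

variable {W : Type*}

/-- The coefficient of `λ^r`. -/
def coeff (r : ℕ) (a : FormalSeries W) : W := a r

/-- The series with given coefficients. -/
def mk (f : ℕ → W) : FormalSeries W := f

@[ext] theorem ext {a b : FormalSeries W} (h : ∀ r, coeff r a = coeff r b) : a = b := funext h

@[simp] theorem coeff_mk (f : ℕ → W) (r : ℕ) : coeff r (mk f) = f r := rfl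

/-- An element of `W` as a constant series. -/
def const [Zero W] (w : W) : FormalSeries W := mk fun r => if r = 0 then w else 0

instance [AddCommGroup W] : AddCommGroup (FormalSeries W) :=
  inferInstanceAs (AddCommGroup (ℕ → W))

@[simp] theorem coeff_add [AddCommGroup W] (r : ℕ) (a b : FormalSeries W) :
    coeff r (a + b) = coeff r a + coeff r b := rfl

@[simp] theorem coeff_zero [AddCommGroup W] (r : ℕ) : coeff r (0 : FormalSeries W) = 0 := rfl

/-- The `ℂ[[λ]]`-module structure of `W[[λ]]`. -/
instance [AddCommGroup W] [Module ℂ W] : SMul ℂ⟦X⟧ (FormalSeries W) where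
  smul c a := mk fun r => ∑ p ∈ Finset.HasAntidiagonal.antidiagonal r, PowerSeries.coeff p.1 c • coeff p.2 a

theorem coeff_smul [AddCommGroup W] [Module ℂ W] (r : ℕ) (c : ℂ⟦X⟧) (a : FormalSeries W) :
    coeff r (c • a) = ∑ p ∈ Finset.HasAntidiagonal.antidiagonal r, PowerSeries.coeff p.1 c • coeff p.2 a := rfl

instance [AddCommGroup W] [Module ℂ W] : Module ℂ⟦X⟧ (FormalSeries W) where
  one_smul a := by
    ext r
    rw [coeff_smul, Finset.sum_eq_single (0, r)]
    · simp
    · rintro ⟨i, j⟩ hij hne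
      have : i ≠ 0 := by
        rintro rfl
        exact hne (by simpa using hij)
      simp [PowerSeries.coeff_one, this]
    · intro h
      simp at h
  mul_smul c c' a := by
    ext r
    simp only [coeff_smul, PowerSeries.coeff_mul, Finset.sum_smul, Finset.smul_sum, mul_smul]
    rw [Finset.sum_sigma', Finset.sum_sigma']
    refine Finset.sum_nbij' (fun x => ⟨(x.2.1, x.2.2 + x.1.2), (x.2.2, x.1.2)⟩)
      (fun x => ⟨(x.1.1 + x.2.1, x.2.2), (x.1.1, x.2.1)⟩) ?_ ?_ ?_ ?_ ?_
    · rintro ⟨⟨i, j⟩, ⟨k, l⟩⟩ h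
      simp only [Finset.mem_sigma, Finset.HasAntidiagonal.mem_antidiagonal, and_true] at h ⊢
      omega
    · rintro ⟨⟨i, j⟩, ⟨k, l⟩⟩ h
      simp only [Finset.mem_sigma, Finset.HasAntidiagonal.mem_antidiagonal, and_true] at h ⊢
      omega
    · rintro ⟨⟨i, j⟩, ⟨k, l⟩⟩ h
      simp only [Finset.mem_sigma, Finset.HasAntidiagonal.mem_antidiagonal] at h ⊢
      obtain ⟨-, rfl⟩ := h
      rfl
    · rintro ⟨⟨i, j⟩, ⟨k, l⟩⟩ h
      simp only [Finset.mem_sigma, Finset.HasAntidiagonal.mem_antidiagonal] at h ⊢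
      obtain ⟨-, rfl⟩ := h
      rfl
    · rintro ⟨⟨i, j⟩, ⟨k, l⟩⟩ h
      rfl
  smul_zero c := by ext r; simp [coeff_smul]
  smul_add c a b := by ext r; simp [coeff_smul, Finset.sum_add_distrib]
  add_smul c c' a := by ext r; simp [coeff_smul, add_smul, Finset.sum_add_distrib]
  zero_smul a := by ext r; simp [coeff_smul]

/-- The coefficientwise involution of `W[[λ]]` (so `λ` is real). -/
instance [AddCommGroup W] [StarAddMonoid W] : StarAddMonoid (FormalSeries W) where
  star a := mk fun r => star (coeff r a)
  star_involutive a := by ext r; exact star_star _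
  star_add a b := by ext r; exact star_add _ _

@[simp] theorem coeff_star [AddCommGroup W] [StarAddMonoid W] (r : ℕ) (a : FormalSeries W) :
    coeff r (star a) = star (coeff r a) := rfl

end FormalSeries

namespace FormalMorita

/-! ## The ordered ring `ℝ[[λ]]` and its extension `ℂ[[λ]]` -/

/-- The complex conjugation of `ℂ[[λ]] = ℝ[[λ]](i)`. -/
instance : StarRing ℂ⟦X⟧ where
  star c := PowerSeries.map (starRingEnd ℂ) c
  star_involutive c := by ext r; simp
  star_mul c c' := by rw [map_mul, mul_comm]
  star_add c c' := map_add _ _ _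

theorem coeff_star (r : ℕ) (c : ℂ⟦X⟧) :
    PowerSeries.coeff r (star c) = star (PowerSeries.coeff r c) :=
  PowerSeries.coeff_map _ _ _

/-- A real series is positive if its first nonvanishing coefficient is positive. -/
def RealPos (a : ℝ⟦X⟧) : Prop :=
  ∃ r, 0 < PowerSeries.coeff r a ∧ ∀ s < r, PowerSeries.coeff s a = 0

/-- `z > 0` in `ℂ[[λ]]`: the series `z` is real and positive. -/
def Pos (z : ℂ⟦X⟧) : Prop := ∃ a : ℝ⟦X⟧, RealPos a ∧ z = PowerSeries.map Complex.ofRealHom a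

/-- `z ≥ 0` in `ℂ[[λ]]`. -/
def Nonneg (z : ℂ⟦X⟧) : Prop := z = 0 ∨ Pos z

theorem star_smul_series {W : Type*} [AddCommGroup W] [Module ℂ W] [StarAddMonoid W]
    [StarModule ℂ W] (c : ℂ⟦X⟧) (a : FormalSeries W) : star (c • a) = star c • star a := by
  ext r
  simp only [FormalSeries.coeff_star, FormalSeries.coeff_smul, star_sum, star_smul, coeff_star]

/-! ## Unital `*`-algebras over `ℂ[[λ]]` and formal Morita equivalence -/

section StarAlgebras

variable (A : Type*) [Ring A] [Algebra ℂ⟦X⟧ A] [StarRing A]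

/-- Positive linear functionals. -/
def IsPositiveFunctional (f : A →ₗ[ℂ⟦X⟧] ℂ⟦X⟧) : Prop := ∀ a : A, Nonneg (f (star a * a))

variable {A} in
/-- Positive algebra elements: every positive linear functional is nonnegative on them. -/
def IsPositiveElement (a : A) : Prop :=
  ∀ f : A →ₗ[ℂ⟦X⟧] ℂ⟦X⟧, IsPositiveFunctional A f → Nonneg (f a)

/-- The structure of a pre-Hilbert space over `ℂ[[λ]]` on a module: a positive definite
Hermitian inner product, linear in the second argument. -/
structure PreHilbert (H : Type*) [AddCommGroup H] [Module ℂ⟦X⟧ H] where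
  inner : H → H → ℂ⟦X⟧
  inner_add_right : ∀ φ ψ χ, inner φ (ψ + χ) = inner φ ψ + inner φ χ
  inner_smul_right : ∀ φ (c : ℂ⟦X⟧) ψ, inner φ (c • ψ) = c * inner φ ψ
  star_inner : ∀ φ ψ, star (inner φ ψ) = inner ψ φ
  inner_self_pos : ∀ φ, φ ≠ 0 → Pos (inner φ φ)

/-- `*`-representations of `A` on a pre-Hilbert space (not required to preserve the unit). -/
structure StarRep {H : Type*} [AddCommGroup H] [Module ℂ⟦X⟧ H] (S : PreHilbert H) where
  toLinearMap : A →ₗ[ℂ⟦X⟧] Module.End ℂ⟦X⟧ H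
  map_mul : ∀ a b, toLinearMap (a * b) = toLinearMap a * toLinearMap b
  adjoint : ∀ a φ ψ, S.inner (toLinearMap a φ) ψ = S.inner φ (toLinearMap (star a) ψ)

/-- For an `A`-valued inner product on `E` and every `*`-representation `ρ` of `A` on a
pre-Hilbert space `H`, the induced inner product
`⟨∑ x_i ⊗ ψ_i, ∑ x_j ⊗ ψ_j⟩ = ∑ ⟨ψ_i, ρ(⟨x_i, x_j⟩) ψ_j⟩` on the balanced tensor product of
`E` and `H` over `A` is positive semi-definite. -/
def TensorPositive.{w, u, v} (A : Type u) [Ring A] [Algebra ℂ⟦X⟧ A] [StarRing A]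
    {E : Type v} (ip : E → E → A) : Prop :=
  ∀ (H : Type w) [AddCommGroup H] [Module ℂ⟦X⟧ H] (S : PreHilbert H) (ρ : StarRep A S)
    (m : ℕ) (x : Fin m → E) (ψ : Fin m → H),
    Nonneg (∑ i, ∑ j, S.inner (ψ i) (ρ.toLinearMap (ip (x i) (x j)) (ψ j)))

/-- The inner products making a `(B-A)`-bimodule `E` into an equivalence bimodule.
The right action of `A` is written as a left action of `Aᵐᵒᵖ`. -/
structure EquivalenceBimodule.{w, u, v, t} (A : Type u) [Ring A] [Algebra ℂ⟦X⟧ A] [StarRing A]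
    (B : Type v) [Ring B] [Algebra ℂ⟦X⟧ B] [StarRing B]
    (E : Type t) [AddCommGroup E] [Module ℂ⟦X⟧ E] [Module B E] [Module Aᵐᵒᵖ E] where
  inner : E → E → A
  inner_add_right : ∀ x y z, inner x (y + z) = inner x y + inner x z
  inner_smul_right : ∀ x (c : ℂ⟦X⟧) y, inner x (c • y) = c • inner x y
  inner_op_smul_right : ∀ x y (a : A), inner x (MulOpposite.op a • y) = inner x y * a
  star_inner : ∀ x y, star (inner x y) = inner y x
  inner_self_pos : ∀ x, IsPositiveElement (inner x x)
  /-- Fullness: the values of the inner product span the algebra. -/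
  inner_full : Submodule.span ℂ⟦X⟧ {a : A | ∃ x y, a = inner x y} = ⊤
  theta : E → E → B
  theta_add_left : ∀ x y z, theta (x + y) z = theta x z + theta y z
  theta_smul_left : ∀ (c : ℂ⟦X⟧) x y, theta (c • x) y = c • theta x y
  theta_act_left : ∀ (b : B) x y, theta (b • x) y = b * theta x y
  star_theta : ∀ x y, star (theta x y) = theta y x
  theta_self_pos : ∀ x, IsPositiveElement (theta x x)
  theta_full : Submodule.span ℂ⟦X⟧ {b : B | ∃ x y, b = theta x y} = ⊤
  inner_act : ∀ x (b : B) y, inner x (b • y) = inner (star b • x) y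
  theta_act : ∀ x (a : A) y,
    theta x (MulOpposite.op a • y) = theta (MulOpposite.op (star a) • x) y
  compat : ∀ x y z, theta x y • z = MulOpposite.op (inner y z) • x
  /-- Property (P). -/
  propertyP : TensorPositive.{w} A inner
  /-- Property (Q): property (P) for the complex-conjugate bimodule. -/
  propertyQ : TensorPositive.{w} B theta

end StarAlgebras

/-- Formal Morita equivalence of unital `*`-algebras over `ℂ[[λ]]`. The universe `w` is the one
of the pre-Hilbert spaces in properties (P) and (Q). -/
def FormallyMoritaEquivalent.{w, u, v}
    (A : Type u) [Ring A] [Algebra ℂ⟦X⟧ A] [StarRing A] [StarModule ℂ⟦X⟧ A]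
    (B : Type v) [Ring B] [Algebra ℂ⟦X⟧ B] [StarRing B] [StarModule ℂ⟦X⟧ B] : Prop :=
  ∃ (E : Type (max u v)) (_ : AddCommGroup E) (_ : Module ℂ⟦X⟧ E) (_ : Module B E)
    (_ : Module Aᵐᵒᵖ E) (_ : IsScalarTower ℂ⟦X⟧ B E) (_ : IsScalarTower ℂ⟦X⟧ Aᵐᵒᵖ E)
    (_ : SMulCommClass B Aᵐᵒᵖ E), Nonempty (EquivalenceBimodule.{w} A B E)

/-! ## Local Hermitian deformations -/

/-- Notation class for the (closed) support in `M` of functions or endomorphism fields on `M`. -/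
class HasSupport (M : outParam (Type*)) (A : Type*) where
  supp : A → Set M

open HasSupport FormalSeries

section Deformations

variable (A : Type*) [Ring A] [Algebra ℂ A] [StarRing A]

/-- Local Hermitian deformations of a unital `*`-algebra `A` over `ℂ`: associative
`ℂ[[λ]]`-bilinear products `⋆` on `A[[λ]]` with the unit of `A`, with the original product in
lowest order, with the involution of `A`, and with local cochains `C_r`, where
`a ⋆ b = ∑ r, C_r(a, b) λ^r` for `a, b ∈ A`. -/
structure LocalHermitianDeformation {M : Type*} [HasSupport M A] where
  mul : FormalSeries A →ₗ[ℂ⟦X⟧] FormalSeries A →ₗ[ℂ⟦X⟧] FormalSeries A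
  mul_assoc : ∀ a b c, mul (mul a b) c = mul a (mul b c)
  one_mul : ∀ a, mul (const 1) a = a
  mul_one : ∀ a, mul a (const 1) = a
  coeff_zero_mul : ∀ a b : A, coeff 0 (mul (const a) (const b)) = a * b
  star_mul : ∀ a b, star (mul a b) = mul (star b) (star a)
  isLocal : ∀ (r : ℕ) (a b : A),
    supp (coeff r (mul (const a) (const b))) ⊆ supp a ∩ supp b

/-- Local transformations `T = id + ∑ r ≥ 1, T_r λ^r` of `A[[λ]]` preserving the involution.
Every `ℂ[[λ]]`-linear map of `A[[λ]]` is of the form `∑ r, T_r λ^r`. -/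
structure FormalTransformation {M : Type*} [HasSupport M A] where
  toEquiv : FormalSeries A ≃ₗ[ℂ⟦X⟧] FormalSeries A
  coeff_zero_apply : ∀ a : A, coeff 0 (toEquiv (const a)) = a
  map_star : ∀ a, toEquiv (star a) = star (toEquiv a)
  isLocal : ∀ (r : ℕ) (a : A), supp (coeff r (toEquiv (const a))) ⊆ supp a

variable {A} {M : Type*} [HasSupport M A]

/-- Equivalence of local Hermitian deformations. -/
def Equivalent (D₁ D₂ : LocalHermitianDeformation A) : Prop :=
  ∃ T : FormalTransformation A, ∀ a b,
    T.toEquiv (D₁.mul a b) = D₂.mul (T.toEquiv a) (T.toEquiv b)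

variable (A) in
/-- `Def^*(A)`: local Hermitian deformations of `A` up to equivalence (`Quot` identifies
exactly the equivalent ones, equivalence being reflexive, symmetric and transitive). -/
def DefStar : Type _ := Quot (Equivalent (A := A))

/-- The class `[⋆]`. -/
def DefStar.mk (D : LocalHermitianDeformation A) : DefStar A := Quot.mk _ D

/-- The deformed algebra `(A[[λ]], ⋆)`. -/
def LocalHermitianDeformation.Alg (_D : LocalHermitianDeformation A) : Type _ := FormalSeries A

namespace LocalHermitianDeformation

variable (D : LocalHermitianDeformation A)

/-- A series as an element of the deformed algebra. -/
def ofSeries (a : FormalSeries A) : D.Alg := a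

variable {D} in
/-- The underlying series of an element of the deformed algebra. -/
def Alg.series (a : D.Alg) : FormalSeries A := a

instance : AddCommGroup D.Alg := inferInstanceAs (AddCommGroup (FormalSeries A))
instance : Module ℂ⟦X⟧ D.Alg := inferInstanceAs (Module ℂ⟦X⟧ (FormalSeries A))

instance : Ring D.Alg :=
  { (inferInstance : AddCommGroup D.Alg) with
    mul := fun a b => D.mul a b
    one := const (W := A) 1
    left_distrib := fun a b c => (D.mul a).map_add b c
    right_distrib := fun a b c => D.mul.map_add₂ a b c
    zero_mul := fun a => D.mul.map_zero₂ a
    mul_zero := fun a => (D.mul a).map_zero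
    mul_assoc := D.mul_assoc
    one_mul := D.one_mul
    mul_one := D.mul_one }

instance : Algebra ℂ⟦X⟧ D.Alg :=
  Algebra.ofModule (fun c a b => D.mul.map_smul₂ c a b) (fun c a b => (D.mul a).map_smul c b)

instance : StarRing D.Alg where
  star := fun a => (star (a : FormalSeries A) : FormalSeries A)
  star_involutive := fun a => star_star (R := FormalSeries A) a
  star_mul := D.star_mul
  star_add := fun a b => star_add (R := FormalSeries A) a b

instance [StarModule ℂ A] : StarModule ℂ⟦X⟧ D.Alg where
  star_smul := fun c a => by
    exact star_smul_series c (a : FormalSeries A)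

end LocalHermitianDeformation

end Deformations

end FormalMorita
namespace FormalMorita
section Geometry

open Bundle HasSupport FormalSeries

variable (d : ℕ) (M : Type*) [TopologicalSpace M] [ChartedSpace (EuclideanSpace ℝ (Fin d)) M]

/-- The `*`-algebra `C^∞(M)` of complex-valued smooth functions, with complex conjugation. -/
def SmoothFun : StarSubalgebra ℂ (M → ℂ) where
  carrier := {f | ContMDiff (𝓡 d) 𝓘(ℝ, ℂ) ∞ f}
  mul_mem' hf hg :=
    (contDiff_mul (𝕜 := ℝ) (𝔸 := ℂ)).contMDiff.comp (hf.prodMk_space hg)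
  add_mem' hf hg := ContMDiff.add hf hg
  algebraMap_mem' _ := contMDiff_const
  star_mem' hf := Complex.conjCLE.contDiff.contMDiff.comp hf

instance : HasSupport M (SmoothFun d M) where
  supp f := closure {x | f.1 x ≠ 0}

variable {M} (F : Type*) [NormedAddCommGroup F] [NormedSpace ℂ F]
  (V : M → Type*) [TopologicalSpace (TotalSpace F V)]
  [∀ x, AddCommGroup (V x)] [∀ x, Module ℂ (V x)] [∀ x, TopologicalSpace (V x)]
  [FiberBundle F V]

/-- The section `s` is smooth on the set `U`. -/
def SmoothSectionOn (s : Π x, V x) (U : Set M) : Prop :=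
  ContMDiffOn (𝓡 d) ((𝓡 d).prod 𝓘(ℝ, F)) ∞ (fun x => TotalSpace.mk' F x (s x)) U

variable [VectorBundle ℂ F V] [VectorBundle ℝ F V] [ContMDiffVectorBundle ∞ F V (𝓡 d)]

variable {d F V} in
theorem SmoothSectionOn.add {s t : Π x, V x} {U : Set M} (hs : SmoothSectionOn d F V s U)
    (ht : SmoothSectionOn d F V t U) : SmoothSectionOn d F V (s + t) U :=
  ContMDiffOn.add_section hs ht

variable {d F V} in
theorem SmoothSectionOn.smul {f : M → ℂ} {s : Π x, V x} {U : Set M}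
    (hf : ContMDiffOn (𝓡 d) 𝓘(ℝ, ℂ) ∞ f U) (hs : SmoothSectionOn d F V s U) :
    SmoothSectionOn d F V (fun x => f x • s x) U := by
  intro x₀ hx₀
  have h := hs x₀ hx₀
  set e := trivializationAt F V x₀
  have hx : x₀ ∈ e.baseSet := FiberBundle.mem_baseSet_trivializationAt' x₀
  rw [e.contMDiffWithinAt_section U hx] at h ⊢
  have h2 : ContMDiffWithinAt (𝓡 d) 𝓘(ℝ, F) ∞ (fun x => f x • (e ⟨x, s x⟩).2) U x₀ :=
    (contDiff_smul (𝕜 := ℝ) (𝕜' := ℂ) (F := F)).contMDiff.contMDiffAt.comp_contMDiffWithinAt x₀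
      ((hf x₀ hx₀).prodMk_space h)
  refine h2.congr_of_eventuallyEq ?_ ((e.linear ℂ hx).map_smul _ _)
  filter_upwards [mem_nhdsWithin_of_mem_nhds (e.open_baseSet.mem_nhds hx)] with y hy
  exact (e.linear ℂ hy).map_smul _ _

/-- The `C^∞(M)`-module `Γ^∞(V)` of smooth sections. -/
def Sections : Submodule (SmoothFun d M) (Π x, V x) where
  carrier := {s | SmoothSectionOn d F V s Set.univ}
  add_mem' hs ht := hs.add ht
  zero_mem' := (contMDiff_zeroSection ℝ V).contMDiffOn
  smul_mem' f _ hs := SmoothSectionOn.smul (contMDiffOn_univ.2 f.2) hs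

/-- Hermitian fibre metrics on `V` (linear in the second argument). -/
structure HermitianMetric where
  form : ∀ x, V x → V x → ℂ
  add_right : ∀ x u v w, form x u (v + w) = form x u v + form x u w
  smul_right : ∀ x v (c : ℂ) w, form x v (c • w) = c * form x v w
  conj_symm : ∀ x v w, starRingEnd ℂ (form x v w) = form x w v
  pos : ∀ x v, v ≠ 0 → 0 < (form x v v).re
  smooth : ∀ U : Set M, IsOpen U → ∀ s t : Π x, V x,
    SmoothSectionOn d F V s U → SmoothSectionOn d F V t U →
      ContMDiffOn (𝓡 d) 𝓘(ℝ, ℂ) ∞ (fun x => form x (s x) (t x)) U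

/-- The algebra of smooth sections of the endomorphism bundle of `V`: fields of endomorphisms
of the fibres mapping smooth local sections of `V` to smooth local sections of `V`. -/
def SmoothEnd : Subalgebra ℂ (Π x, Module.End ℂ (V x)) where
  carrier := {T | ∀ U : Set M, IsOpen U → ∀ s : Π x, V x,
    SmoothSectionOn d F V s U → SmoothSectionOn d F V (fun x => T x (s x)) U}
  mul_mem' hT hS U hU s hs := hT U hU _ (hS U hU s hs)
  add_mem' hT hS U hU s hs := (hT U hU s hs).add (hS U hU s hs)
  algebraMap_mem' c U _ s hs := by
    have := SmoothSectionOn.smul (f := fun _ => c) contMDiffOn_const hs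
    simpa [Module.algebraMap_end_apply] using this

namespace HermitianMetric

variable {d F V} (h : HermitianMetric d F V)

theorem add_left (x : M) (u v w : V x) : h.form x (u + v) w = h.form x u w + h.form x v w := by
  rw [← h.conj_symm, h.add_right, map_add, h.conj_symm, h.conj_symm]

theorem smul_left (x : M) (c : ℂ) (v w : V x) :
    h.form x (c • v) w = starRingEnd ℂ c * h.form x v w := by
  rw [← h.conj_symm, h.smul_right, map_mul, h.conj_symm]

theorem eq_zero (x : M) (v : V x) (hv : h.form x v v = 0) : v = 0 := by
  by_contra hne
  have := h.pos x v hne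
  simp [hv] at this

theorem ext_left (x : M) {v w : V x} (hvw : ∀ u, h.form x v u = h.form x w u) : v = w := by
  rw [← sub_eq_zero]
  refine h.eq_zero x _ ?_
  have h1 : v = (v - w) + w := by abel
  have h2 := hvw (v - w)
  rw [h1, h.add_left] at h2
  simpa using h2

variable [FiniteDimensional ℂ F]

theorem exists_adjoint (x : M) (T : Module.End ℂ (V x)) :
    ∃ T' : Module.End ℂ (V x), ∀ v w, h.form x (T' v) w = h.form x v (T w) := by
  let core : InnerProductSpace.Core ℂ (V x) :=
    { inner := h.form x
      conj_inner_symm := fun v w => h.conj_symm x w v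
      re_inner_nonneg := fun v => by
        by_cases hv : v = 0
        · subst hv
          have := h.smul_right x 0 0 0
          simp at this
          simp [this]
        · exact (h.pos x v hv).le
      add_left := h.add_left x
      smul_left := fun v w c => h.smul_left x c v w
      definite := h.eq_zero x }
  letI := core.toNormedAddCommGroup
  letI : InnerProductSpace ℂ (V x) := InnerProductSpace.ofCore core.toCore
  haveI : FiniteDimensional ℂ (V x) :=
    ((trivializationAt F V x).linearEquivAt ℂ x
      (FiberBundle.mem_baseSet_trivializationAt' x)).symm.finiteDimensional
  exact ⟨LinearMap.adjoint T, fun v w => LinearMap.adjoint_inner_left T w v⟩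

/-- The fibrewise adjoint of an endomorphism. -/
def adjoint (x : M) (T : Module.End ℂ (V x)) : Module.End ℂ (V x) :=
  (h.exists_adjoint x T).choose

theorem form_adjoint_left (x : M) (T : Module.End ℂ (V x)) (v w : V x) :
    h.form x (h.adjoint x T v) w = h.form x v (T w) :=
  (h.exists_adjoint x T).choose_spec v w

theorem form_adjoint_right (x : M) (T : Module.End ℂ (V x)) (v w : V x) :
    h.form x v (h.adjoint x T w) = h.form x (T v) w := by
  rw [← h.conj_symm, h.form_adjoint_left, h.conj_symm]

end HermitianMetric

end Geometry
end FormalMorita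
namespace FormalMorita
section Adjoint

open Bundle

variable {d : ℕ} {M : Type*} [TopologicalSpace M] [ChartedSpace (EuclideanSpace ℝ (Fin d)) M]
  {F : Type*} [NormedAddCommGroup F] [NormedSpace ℂ F]
  {V : M → Type*} [TopologicalSpace (TotalSpace F V)]
  [∀ x, AddCommGroup (V x)] [∀ x, Module ℂ (V x)] [∀ x, TopologicalSpace (V x)]
  [FiberBundle F V]

theorem contMDiffOn_det {n : ℕ} {U : Set M} (G : M → Matrix (Fin n) (Fin n) ℝ)
    (hG : ∀ i j, ContMDiffOn (𝓡 d) 𝓘(ℝ, ℝ) ∞ (fun y => G y i j) U) :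
    ContMDiffOn (𝓡 d) 𝓘(ℝ, ℝ) ∞ (fun y => (G y).det) U := by
  have h1 : ∀ σ : Equiv.Perm (Fin n), ContMDiffOn (𝓡 d) 𝓘(ℝ, ℝ) ∞
      (fun y => ((Equiv.Perm.sign σ : ℤ) : ℝ) * ∏ i, G y (σ i) i) U := fun σ =>
    ContMDiffOn.mul contMDiffOn_const (contMDiffOn_finset_prod fun i _ => hG (σ i) i)
  have h2 : ContMDiffOn (𝓡 d) 𝓘(ℝ, ℝ) ∞
      (fun y => ∑ σ : Equiv.Perm (Fin n),
        ((Equiv.Perm.sign σ : ℤ) : ℝ) * ∏ i, G y (σ i) i) U :=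
    contMDiffOn_finset_sum fun σ _ => h1 σ
  refine h2.congr fun y _ => ?_
  rw [Matrix.det_apply']

/-- Cramer's rule with smooth coefficients. -/
theorem contMDiffOn_solution {n : ℕ} {U : Set M} (G : M → Matrix (Fin n) (Fin n) ℝ)
    (r c : M → Fin n → ℝ)
    (hG : ∀ i j, ContMDiffOn (𝓡 d) 𝓘(ℝ, ℝ) ∞ (fun y => G y i j) U)
    (hr : ∀ i, ContMDiffOn (𝓡 d) 𝓘(ℝ, ℝ) ∞ (fun y => r y i) U)
    (hdet : ∀ y ∈ U, (G y).det ≠ 0) (hc : ∀ y ∈ U, (G y).mulVec (c y) = r y) (i : Fin n) :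
    ContMDiffOn (𝓡 d) 𝓘(ℝ, ℝ) ∞ (fun y => c y i) U := by
  have h1 := contMDiffOn_det G hG
  have h2 : ContMDiffOn (𝓡 d) 𝓘(ℝ, ℝ) ∞ (fun y => ((G y).updateCol i (r y)).det) U := by
    refine contMDiffOn_det _ fun j k => ?_
    by_cases hk : k = i
    · subst hk
      simpa using hr j
    · simpa [Matrix.updateCol_apply, hk] using hG j k
  refine (ContMDiffOn.mul (h1.inv₀ hdet) h2).congr fun y hy => ?_
  have h3 : ((G y).updateCol i (r y)).det = (G y).det * c y i := by
    rw [← Matrix.cramer_apply, ← hc y hy, Matrix.cramer_eq_adjugate_mulVec, Matrix.mulVec_mulVec,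
      Matrix.adjugate_mul, Matrix.smul_mulVec, Matrix.one_mulVec]
    rfl
  have := hdet y hy
  change c y i = ((G y).det)⁻¹ * ((G y).updateCol i (r y)).det
  rw [h3]
  field_simp

namespace HermitianMetric

variable (h : HermitianMetric d F V)

/-- The real part of the metric in its second argument. -/
def reForm (x : M) (v : V x) : V x →ₗ[ℝ] ℝ where
  toFun w := (h.form x v w).re
  map_add' u w := by rw [h.add_right, Complex.add_re]
  map_smul' r w := by
    rw [← Complex.coe_smul, h.smul_right, Complex.re_ofReal_mul]
    rfl

theorem reForm_apply (x : M) (v w : V x) : h.reForm x v w = (h.form x v w).re := rfl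

theorem reForm_comm (x : M) (v w : V x) : h.reForm x v w = h.reForm x w v := by
  rw [reForm_apply, reForm_apply, ← h.conj_symm, Complex.conj_re]

variable [VectorBundle ℂ F V] [VectorBundle ℝ F V] [ContMDiffVectorBundle ∞ F V (𝓡 d)]
  [FiniteDimensional ℂ F]

theorem smooth_re {U : Set M} (hU : IsOpen U) {s t : Π x, V x} (hs : SmoothSectionOn d F V s U)
    (ht : SmoothSectionOn d F V t U) :
    ContMDiffOn (𝓡 d) 𝓘(ℝ, ℝ) ∞ (fun x => h.reForm x (s x) (t x)) U :=
  Complex.reCLM.contDiff.contMDiff.comp_contMDiffOn (h.smooth U hU s t hs ht)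

/-- The adjoint of a smooth field of endomorphisms is smooth. -/
theorem adjoint_mem {T : Π x, Module.End ℂ (V x)} (hT : T ∈ SmoothEnd d F V) :
    (fun x => h.adjoint x (T x)) ∈ SmoothEnd d F V := by
  intro U hU s hs x₀ hx₀
  have : FiniteDimensional ℝ F := FiniteDimensional.complexToReal F
  set e := trivializationAt F V x₀
  have hxe : x₀ ∈ e.baseSet := FiberBundle.mem_baseSet_trivializationAt' x₀
  let b := Module.finBasis ℝ F
  have hW : IsOpen (U ∩ e.baseSet) := hU.inter e.open_baseSet
  have hf := (e.isLocalFrameOn_localFrame_baseSet (𝓡 d) ∞ b).mono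
    (Set.inter_subset_right (s := U))
  set f := e.localFrame b
  have hsW : SmoothSectionOn d F V s (U ∩ e.baseSet) := hs.mono Set.inter_subset_left
  have hcoeff : ∀ i, ContMDiffOn (𝓡 d) 𝓘(ℝ, ℝ) ∞
      (fun y => hf.coeff i y (h.adjoint y (T y) (s y))) (U ∩ e.baseSet) := by
    refine contMDiffOn_solution (fun y => Matrix.of fun i j => h.reForm y (f i y) (f j y))
      (fun y i => h.reForm y (T y (f i y)) (s y))
      (fun y i => hf.coeff i y (h.adjoint y (T y) (s y))) ?_ ?_ ?_ ?_
    · exact fun i j => h.smooth_re hW (hf.contMDiffOn i) (hf.contMDiffOn j)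
    · exact fun i => h.smooth_re hW (hT _ hW _ (hf.contMDiffOn i)) hsW
    · intro y hy hdet
      obtain ⟨v, hv, hGv⟩ := Matrix.exists_mulVec_eq_zero_iff.2 hdet
      have h1 : ∀ i, h.reForm y (f i y) (∑ j, v j • f j y) = 0 := fun i => by
        have := congrFun hGv i
        simp only [Matrix.mulVec, dotProduct, Matrix.of_apply, Pi.zero_apply] at this
        simp only [map_sum, map_smul, smul_eq_mul]
        rw [← this]
        exact Finset.sum_congr rfl fun j _ => mul_comm _ _
      have h2 : h.reForm y (∑ j, v j • f j y) (∑ j, v j • f j y) = 0 := by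
        conv_lhs => rw [map_sum]
        refine Finset.sum_eq_zero fun j _ => ?_
        rw [map_smul, h.reForm_comm, h1, smul_zero]
      have h3 : ∑ j, v j • f j y = 0 := by
        by_contra hne
        have := h.pos y _ hne
        rw [← reForm_apply, h2] at this
        exact lt_irrefl _ this
      exact hv (funext fun i => Fintype.linearIndependent_iff.1 (hf.linearIndependent hy) v h3 i)
    · intro y hy
      funext i
      have h1 : h.reForm y (T y (f i y)) (s y) =
          h.reForm y (f i y) (h.adjoint y (T y) (s y)) := by
        rw [reForm_apply, reForm_apply, h.form_adjoint_right]
      have h2 := hf.coeff_sum_eq (fun y => h.adjoint y (T y) (s y)) hy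
      rw [h1]
      conv_rhs => rw [h2]
      simp only [Matrix.mulVec, dotProduct, Matrix.of_apply, map_sum, map_smul, smul_eq_mul]
      exact Finset.sum_congr rfl fun j _ => mul_comm _ _
  have := hf.contMDiffOn_of_coeff (t := fun y => h.adjoint y (T y) (s y)) hcoeff
  exact ((this x₀ ⟨hx₀, hxe⟩).contMDiffAt (hW.mem_nhds ⟨hx₀, hxe⟩)).contMDiffWithinAt

end HermitianMetric
end Adjoint
end FormalMorita
namespace FormalMorita
section Phi

open Bundle HasSupport FormalSeries

variable {d : ℕ} {M : Type*} [TopologicalSpace M] [ChartedSpace (EuclideanSpace ℝ (Fin d)) M]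
  {F : Type*} [NormedAddCommGroup F] [NormedSpace ℂ F] [FiniteDimensional ℂ F]
  {V : M → Type*} [TopologicalSpace (TotalSpace F V)]
  [∀ x, AddCommGroup (V x)] [∀ x, Module ℂ (V x)] [∀ x, TopologicalSpace (V x)]
  [FiberBundle F V] [VectorBundle ℂ F V] [VectorBundle ℝ F V] [ContMDiffVectorBundle ∞ F V (𝓡 d)]

/-- The `*`-algebra `Γ^∞(End(V))`, with the involution given by the Hermitian metric. -/
def EndSections (_h : HermitianMetric d F V) : Type _ := SmoothEnd d F V

namespace EndSections

variable (h : HermitianMetric d F V)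

instance : Ring (EndSections h) := inferInstanceAs (Ring (SmoothEnd d F V))
instance : Algebra ℂ (EndSections h) := inferInstanceAs (Algebra ℂ (SmoothEnd d F V))

variable {h}

/-- The value of an endomorphism field at a point. -/
def fib (T : EndSections h) (x : M) : Module.End ℂ (V x) := T.1 x

theorem ext {T S : EndSections h} (hTS : ∀ x v, T.fib x v = S.fib x v) : T = S :=
  Subtype.ext (funext fun x => LinearMap.ext (hTS x))

instance : StarRing (EndSections h) where
  star T := ⟨fun x => h.adjoint x (T.fib x), h.adjoint_mem T.2⟩
  star_involutive T := ext fun x v => h.ext_left x fun u => by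
    change h.form x (h.adjoint x (h.adjoint x (T.fib x)) v) u = _
    rw [h.form_adjoint_left, h.form_adjoint_right]
  star_mul T S := ext fun x v => h.ext_left x fun u => by
    change h.form x (h.adjoint x (T.fib x * S.fib x) v) u =
      h.form x (h.adjoint x (S.fib x) (h.adjoint x (T.fib x) v)) u
    rw [h.form_adjoint_left, h.form_adjoint_left, h.form_adjoint_left]
    rfl
  star_add T S := ext fun x v => h.ext_left x fun u => by
    change h.form x (h.adjoint x (T.fib x + S.fib x) v) u =
      h.form x (h.adjoint x (T.fib x) v + h.adjoint x (S.fib x) v) u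
    rw [h.form_adjoint_left, h.add_left, h.form_adjoint_left, h.form_adjoint_left, ← h.add_right]
    rfl

instance : StarModule ℂ (EndSections h) where
  star_smul c T := ext fun x v => h.ext_left x fun u => by
    change h.form x (h.adjoint x (c • T.fib x) v) u =
      h.form x (starRingEnd ℂ c • h.adjoint x (T.fib x) v) u
    rw [h.form_adjoint_left, h.smul_left, h.form_adjoint_left, Complex.conj_conj,
      ← h.smul_right]
    rfl

instance : HasSupport M (EndSections h) where
  supp T := closure {x | T.fib x ≠ 0}

/-- The action of endomorphism fields on smooth sections. -/
def act (T : EndSections h) (s : Sections d F V) : Sections d F V :=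
  ⟨fun x => T.fib x (s.1 x), T.2 Set.univ isOpen_univ s.1 s.2⟩

end EndSections

/-- The `C^∞(M)`-valued inner product of smooth sections. -/
def HermitianMetric.pairing (h : HermitianMetric d F V) (s t : Sections d F V) : SmoothFun d M :=
  ⟨fun x => h.form x (s.1 x) (t.1 x),
    contMDiffOn_univ.1 (h.smooth Set.univ isOpen_univ s.1 t.1 s.2 t.2)⟩

/-- An identification `Γ^∞(V) = P₀ 𝒜^n` of inner product modules over `𝒜 = C^∞(M)`, where
`P₀ ∈ M_n(𝒜)` is a projection and `P₀ 𝒜^n` carries the inner product `∑ x_i^* y_i`. -/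
structure Presentation (h : HermitianMetric d F V) where
  n : ℕ
  P : Matrix (Fin n) (Fin n) (SmoothFun d M)
  star_P : star P = P
  P_mul_P : P * P = P
  equiv : Sections d F V ≃ₗ[SmoothFun d M] LinearMap.range P.mulVecLin
  isometry : ∀ s t, ∑ i, star ((equiv s).1 i) * (equiv t).1 i = h.pairing s t

variable {h : HermitianMetric d F V}

/-- The matrix in `P₀ M_n(𝒜) P₀` of an element of `Γ^∞(End(V)) = P₀ M_n(𝒜) P₀`: its `j`-th
column is the image of `P₀ e_j`. -/
def Presentation.matrix (p : Presentation h) (T : EndSections h) :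
    Matrix (Fin p.n) (Fin p.n) (SmoothFun d M) :=
  Matrix.of fun i j =>
    (p.equiv (T.act (p.equiv.symm (p.P.mulVecLin.rangeRestrict (Pi.single j 1))))).1 i

/-- A projection in `M_n((C^∞(M)[[λ]], ⋆))` deforming `P₀`. -/
structure DeformedProjection (p : Presentation h)
    (D : LocalHermitianDeformation (SmoothFun d M)) where
  Q : Matrix (Fin p.n) (Fin p.n) D.Alg
  star_Q : star Q = Q
  Q_mul_Q : Q * Q = Q
  coeff_zero : ∀ i j, coeff 0 (Q i j).series = p.P i j

/-- The map `I : P₀ M_n(𝒜) P₀[[λ]] → 𝐏 ⋆ M_n(𝐀) ⋆ 𝐏`, `L ↦ 𝐏 ⋆ L ⋆ 𝐏`, precomposed with the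
identification `Γ^∞(End(V)) = P₀ M_n(𝒜) P₀`. -/
def DeformedProjection.I {p : Presentation h} {D : LocalHermitianDeformation (SmoothFun d M)}
    (Q : DeformedProjection p D) (b : FormalSeries (EndSections h)) :
    Matrix (Fin p.n) (Fin p.n) D.Alg :=
  Q.Q * (Matrix.of fun i j =>
    D.ofSeries (FormalSeries.mk fun r => p.matrix (coeff r b) i j)) * Q.Q

/-- The map `Φ : Def^*(C^∞(M)) → Def^*(Γ^∞(End(V)))`, given by its graph `c' = Φ(c)`. The
choices below do not affect the class of `⋆'`. The
product `⋆'` is equivalent, through a transformation `T`, to the product on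
`Γ^∞(End(V))[[λ]]` obtained by pulling back the product of `𝐏 ⋆ M_n(𝐀) ⋆ 𝐏` along `I`, for a
presentation `Γ^∞(V) = P₀ 𝒜^n` and a projection `𝐏` deforming `P₀`. (The unit of the
pulled-back product need not be the constant `1`; `T` restores it.) -/
def Phi (h : HermitianMetric d F V) (c : DefStar (SmoothFun d M))
    (c' : DefStar (EndSections h)) : Prop :=
  ∃ (D : LocalHermitianDeformation (SmoothFun d M)) (D' : LocalHermitianDeformation (EndSections h))
    (p : Presentation h) (Q : DeformedProjection p D) (T : FormalTransformation (EndSections h)),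
    DefStar.mk D = c ∧ DefStar.mk D' = c' ∧
      ∀ a b, Q.I (T.toEquiv (D'.mul a b)) = Q.I (T.toEquiv a) * Q.I (T.toEquiv b)

end Phi
end FormalMorita
end

universe u v w t

open FormalMorita

/-! The equivalence bimodule is the deformed section module `𝐏 ⋆ 𝐀ⁿ`. It carries `⟨x, y⟩ = ∑ xᵢ* ⋆
yᵢ`, and the rank one matrices `x y*` are pulled back along an isomorphism of `𝐁` with the corner `𝐏
⋆ M_n(𝐀) ⋆ 𝐏`. The algebraic axioms are matrix identities, and (P) holds because `⟨x, y⟩` is a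
finite sum of terms `a(x)* a(y)` (`tensorPositive_of_eq_sum`).

The remaining axioms about `⟨·,·⟩` fullness and `Θ` positivity come from one object, a finite family
`y_k` in the module with `∑ ⟨y_k, y_k⟩ = 1`. Inserting this 1 between `x` and `z*` gives `Θ_{x,z} =
∑ Θ_{y_k,x}* Θ_{y_k,z}`, so `Θ` has the same form as `⟨·,·⟩` and (Q) follows
(`CornerIso.formallyMoritaEquivalent`). Also `a = ∑ ⟨y_k, y_k a⟩`, which is fullness.

The family is found by rescaling the columns of `𝐏`: their squares sum to the diagonal sum of `𝐏`,
whose classical limit is `tr P₀`, the constant rank `k ≥ 1` (`Presentation.trace_P`). After division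
by `k` this is a Hermitian element `1 + O(λ)`, which has a Hermitian inverse square root in `𝐀`
(`exists_invSqrt`), and multiplying the columns by that root normalises them (`exists_normalised`).

The corner isomorphism is `I` composed with `T`. To lowest order `I` is the classical isomorphism
`Γ^∞(End E) = P₀ M_n(𝒜) P₀`, so it is bijective onto the corner by induction on the order in `λ`
(`I_injective`, `exists_I_eq`). Equivalent deformations give `*`-isomorphic algebras, so the choice
of representatives in `Φ` is harmless. -/

namespace FormalMorita

/-! ### Positivity over `ℂ[[λ]]` and a criterion for property (P) -/

section Positivity

theorem RealPos.add {a b : ℝ⟦X⟧} (ha : RealPos a) (hb : RealPos b) : RealPos (a + b) := by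
  obtain ⟨r, hr, hr'⟩ := ha
  obtain ⟨s, hs, hs'⟩ := hb
  rcases lt_trichotomy r s with h | rfl | h
  · exact ⟨r, by rw [map_add, hs' r h, add_zero]; exact hr, fun k hk => by
      rw [map_add, hr' k hk, hs' k (hk.trans h), add_zero]⟩
  · exact ⟨r, by rw [map_add]; exact add_pos hr hs, fun k hk => by
      rw [map_add, hr' k hk, hs' k hk, add_zero]⟩
  · exact ⟨s, by rw [map_add, hr' s h, zero_add]; exact hs, fun k hk => by
      rw [map_add, hr' k (hk.trans h), hs' k hk, add_zero]⟩

theorem Nonneg.add {y z : ℂ⟦X⟧} (hy : Nonneg y) (hz : Nonneg z) : Nonneg (y + z) := by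
  rcases hy with rfl | ⟨a, ha, rfl⟩
  · rwa [zero_add]
  rcases hz with rfl | ⟨b, hb, rfl⟩
  · rw [add_zero]; exact Or.inr ⟨a, ha, rfl⟩
  · exact Or.inr ⟨a + b, ha.add hb, by rw [map_add]⟩

theorem Nonneg.sum {ι : Type*} {s : Finset ι} {f : ι → ℂ⟦X⟧} (hf : ∀ i ∈ s, Nonneg (f i)) :
    Nonneg (∑ i ∈ s, f i) :=
  Finset.sum_induction f Nonneg (fun _ _ => Nonneg.add) (Or.inl rfl) hf

theorem IsPositiveElement.sum_star_mul_self {A : Type*} [Ring A] [Algebra ℂ⟦X⟧ A] [StarRing A]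
    {ι : Type*} (s : Finset ι) (a : ι → A) : IsPositiveElement (∑ i ∈ s, star (a i) * a i) :=
  fun f hf => by
    rw [map_sum]
    exact Nonneg.sum fun i _ => hf (a i)

namespace PreHilbert

variable {H : Type*} [AddCommGroup H] [Module ℂ⟦X⟧ H] (S : PreHilbert H)

theorem inner_zero_right (φ : H) : S.inner φ 0 = 0 := by
  simpa using S.inner_smul_right φ 0 0

theorem inner_add_left (φ ψ χ : H) : S.inner (φ + ψ) χ = S.inner φ χ + S.inner ψ χ := by
  rw [← S.star_inner, S.inner_add_right, star_add, S.star_inner, S.star_inner]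

theorem inner_self_nonneg (φ : H) : Nonneg (S.inner φ φ) := by
  by_cases h : φ = 0
  · subst h
    exact Or.inl (S.inner_zero_right 0)
  · exact Or.inr (S.inner_self_pos φ h)

theorem inner_sum_right {ι : Type*} (s : Finset ι) (φ : H) (ψ : ι → H) :
    S.inner φ (∑ i ∈ s, ψ i) = ∑ i ∈ s, S.inner φ (ψ i) :=
  map_sum (AddMonoidHom.mk' (S.inner φ) (S.inner_add_right φ)) ψ s

theorem inner_sum_left {ι : Type*} (s : Finset ι) (φ : ι → H) (ψ : H) :
    S.inner (∑ i ∈ s, φ i) ψ = ∑ i ∈ s, S.inner (φ i) ψ :=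
  map_sum (AddMonoidHom.mk' (S.inner · ψ) fun _ _ => S.inner_add_left _ _ ψ) φ s

end PreHilbert

/-- An inner product which is a finite sum of terms `(a x)^* (a y)` satisfies property (P). -/
theorem tensorPositive_of_eq_sum {A : Type*} [Ring A] [Algebra ℂ⟦X⟧ A] [StarRing A]
    {E : Type*} {ip : E → E → A} {κ : Type*} [Fintype κ] (a : κ → E → A)
    (hip : ∀ x y, ip x y = ∑ k, star (a k x) * a k y) : TensorPositive.{w} A ip := by
  intro H _ _ S ρ m x ψ
  -- Moving each `ρ (star (a k (x i)))` to the left slot turns the double sum into a sum over `k` of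
  -- squared lengths of `∑ i, ρ (a k (x i)) (ψ i)`.
  have key : ∑ i, ∑ j, S.inner (ψ i) (ρ.toLinearMap (ip (x i) (x j)) (ψ j)) =
      ∑ k, S.inner (∑ i, ρ.toLinearMap (a k (x i)) (ψ i))
        (∑ j, ρ.toLinearMap (a k (x j)) (ψ j)) := by
    simp only [hip, map_sum, LinearMap.sum_apply, S.inner_sum_right, S.inner_sum_left, ρ.map_mul,
      Module.End.mul_apply, ρ.adjoint]
    rw [Finset.sum_comm' (t' := Finset.univ) (s' := fun _ => Finset.univ) (by simp)]
    refine (Finset.sum_congr rfl fun j _ => Finset.sum_comm).trans ?_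
    rw [Finset.sum_comm]
  rw [key]
  exact Nonneg.sum fun k _ => S.inner_self_nonneg _

end Positivity

/-! ### Rank one matrices and the module `Q Aⁿ` -/

section Corner

open Matrix MulOpposite

variable {A : Type*} [Ring A] [StarRing A]

/-- The standard inner product of `A^n`. -/
def stdInner {n : ℕ} (x y : Fin n → A) : A := ∑ i, star (x i) * y i

/-- The rank one matrix `x y^*`. -/
def rankOne {n : ℕ} (x y : Fin n → A) : Matrix (Fin n) (Fin n) A :=
  Matrix.of fun i j => x i * star (y j)

theorem rankOne_mulVec {n : ℕ} (x y z : Fin n → A) :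
    rankOne x y *ᵥ z = op (stdInner y z) • x := by
  ext i
  simp [rankOne, stdInner, Matrix.mulVec, dotProduct, Finset.mul_sum, mul_assoc]

theorem star_rankOne {n : ℕ} (x y : Fin n → A) : star (rankOne x y) = rankOne y x := by
  ext i j
  simp [rankOne, Matrix.star_apply]

theorem mul_rankOne {n : ℕ} (L : Matrix (Fin n) (Fin n) A) (x y : Fin n → A) :
    L * rankOne x y = rankOne (L *ᵥ x) y := by
  ext i j
  simp [rankOne, Matrix.mulVec, dotProduct, Matrix.mul_apply, Finset.sum_mul, mul_assoc]

theorem rankOne_mul_rankOne {n : ℕ} (x y z w : Fin n → A) :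
    rankOne x y * rankOne z w = rankOne (op (stdInner y z) • x) w := by
  rw [mul_rankOne, rankOne_mulVec]

theorem star_stdInner {n : ℕ} (x y : Fin n → A) : star (stdInner x y) = stdInner y x := by
  simp [stdInner]

theorem stdInner_mulVec {n : ℕ} (L : Matrix (Fin n) (Fin n) A) (x y : Fin n → A) :
    stdInner x (L *ᵥ y) = stdInner (star L *ᵥ x) y := by
  simp only [stdInner, Matrix.mulVec, dotProduct, star_sum, star_mul, Matrix.star_apply, star_star,
    Finset.mul_sum, Finset.sum_mul, mul_assoc]
  exact Finset.sum_comm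

/-- For a projection `L = Q` the right side is `Q`, the unit of the corner; this makes `Θ` full. -/
theorem sum_rankOne_col {n : ℕ} (L : Matrix (Fin n) (Fin n) A) :
    ∑ j, rankOne (L.col j) (L.col j) = L * star L := by
  ext i k
  simp [rankOne, Matrix.sum_apply, Matrix.mul_apply, Matrix.star_apply]

/-- The right `A`-module `Q A^n`. -/
def corner {A : Type*} [Ring A] {n : ℕ} (Q : Matrix (Fin n) (Fin n) A) :
    Submodule Aᵐᵒᵖ (Fin n → A) where
  carrier := {x | Q *ᵥ x = x}
  add_mem' hx hy := by
    rw [Set.mem_ofPred_eq] at *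
    rw [Matrix.mulVec_add, hx, hy]
  zero_mem' := Matrix.mulVec_zero Q
  smul_mem' a x hx := by
    rw [Set.mem_ofPred_eq] at *
    rw [Matrix.mulVec_smul, hx]

end Corner
end FormalMorita

namespace FormalMorita

/-! ### The equivalence bimodule of a corner -/

section Corner

open Matrix MulOpposite

variable {A : Type u} [Ring A] [Algebra ℂ⟦X⟧ A] [StarRing A]
  {B : Type v} [Ring B] [Algebra ℂ⟦X⟧ B] [StarRing B]

variable (B) in
/-- An isomorphism of a unital `*`-algebra `B` with the corner `Q M_n(A) Q`. -/
structure CornerIso {n : ℕ} (Q : Matrix (Fin n) (Fin n) A) where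
  toLinearMap : B →ₗ[ℂ⟦X⟧] Matrix (Fin n) (Fin n) A
  map_one : toLinearMap 1 = Q
  map_mul : ∀ a b, toLinearMap (a * b) = toLinearMap a * toLinearMap b
  map_star : ∀ b, toLinearMap (star b) = star (toLinearMap b)
  injective : Function.Injective toLinearMap
  exists_eq : ∀ L, Q * L * Q = L → ∃ b, toLinearMap b = L

namespace CornerIso

variable {n : ℕ} {Q : Matrix (Fin n) (Fin n) A}

theorem mul_map (J : CornerIso B Q) (b : B) : Q * J.toLinearMap b = J.toLinearMap b :=
  calc Q * J.toLinearMap b = J.toLinearMap 1 * J.toLinearMap b := by rw [J.map_one]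
    _ = J.toLinearMap b := by rw [← J.map_mul, one_mul]

theorem map_mul_self (J : CornerIso B Q) (b : B) : J.toLinearMap b * Q = J.toLinearMap b :=
  calc J.toLinearMap b * Q = J.toLinearMap b * J.toLinearMap 1 := by rw [J.map_one]
    _ = J.toLinearMap b := by rw [← J.map_mul, mul_one]

/-- With `mul_self`, this recovers that `Q` is a projection from its being the image of 1. -/
theorem star_eq (J : CornerIso B Q) : star Q = Q :=
  calc star Q = star (J.toLinearMap 1) := by rw [J.map_one]
    _ = Q := by rw [← J.map_star, star_one, J.map_one]

theorem mul_self (J : CornerIso B Q) : Q * Q = Q :=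
  calc Q * Q = Q * J.toLinearMap 1 := by rw [J.map_one]
    _ = Q := by rw [J.mul_map, J.map_one]

theorem map_mulVec (J : CornerIso B Q) (b : B) (x : Fin n → A) : Q *ᵥ (J.toLinearMap b *ᵥ x) =
    J.toLinearMap b *ᵥ x := by
  rw [Matrix.mulVec_mulVec, J.mul_map]

/-- The left action of `B = Q M_n(A) Q` on `Q A^n`. -/
@[reducible] noncomputable def module (J : CornerIso B Q) : Module B (corner Q) where
  smul b x := ⟨J.toLinearMap b *ᵥ x.1, J.map_mulVec b x.1⟩
  one_smul x := Subtype.ext <| by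
    change J.toLinearMap 1 *ᵥ x.1 = x.1
    rw [J.map_one]
    exact x.2
  mul_smul a b x := Subtype.ext <| by
    change J.toLinearMap (a * b) *ᵥ x.1 = J.toLinearMap a *ᵥ (J.toLinearMap b *ᵥ x.1)
    rw [J.map_mul, Matrix.mulVec_mulVec]
  smul_zero b := Subtype.ext (Matrix.mulVec_zero (J.toLinearMap b))
  smul_add b x y := Subtype.ext (Matrix.mulVec_add (J.toLinearMap b) x.1 y.1)
  add_smul a b x := Subtype.ext <| by
    change J.toLinearMap (a + b) *ᵥ x.1 = J.toLinearMap a *ᵥ x.1 + J.toLinearMap b *ᵥ x.1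
    rw [map_add, Matrix.add_mulVec]
  zero_smul x := Subtype.ext <| by
    change J.toLinearMap 0 *ᵥ x.1 = 0
    rw [map_zero, Matrix.zero_mulVec]

/-- `Q (x y*) Q = (Q x)(Q y)*` because `Q` is Hermitian, and `Q` fixes `x` and `y`. -/
theorem exists_theta (J : CornerIso B Q) (x y : corner Q) :
    ∃ b, J.toLinearMap b = rankOne x.1 y.1 := by
  refine J.exists_eq _ ?_
  rw [mul_rankOne, show Q *ᵥ x.1 = x.1 from x.2, ← star_star (rankOne x.1 y.1 * Q), star_mul,
    star_rankOne, J.star_eq, mul_rankOne, show Q *ᵥ y.1 = y.1 from y.2, star_rankOne]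

/-- The `B`-valued inner product `x y^*` of `Q A^n`. -/
noncomputable def theta (J : CornerIso B Q) (x y : corner Q) : B := (J.exists_theta x y).choose

theorem map_theta (J : CornerIso B Q) (x y : corner Q) :
    J.toLinearMap (J.theta x y) = rankOne x.1 y.1 :=
  (J.exists_theta x y).choose_spec

/-- A finite family in `Q A^n` which is normalised for the `A`-valued inner product makes
`Q A^n` an equivalence bimodule. -/
theorem formallyMoritaEquivalent (J : CornerIso B Q) [StarModule ℂ⟦X⟧ A] [StarModule ℂ⟦X⟧ B]
    {κ : Type*} [Fintype κ] (y : κ → corner Q)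
    (hy : ∑ k, stdInner (y k).1 (y k).1 = 1) : FormallyMoritaEquivalent.{w} A B := by
  obtain ⟨_, hact⟩ : ∃ _ : Module B (corner Q), ∀ (b : B) (x : corner Q),
      (b • x).1 = J.toLinearMap b *ᵥ x.1 := ⟨J.module, fun _ _ => rfl⟩
  have hstar : ∀ x z : corner Q, star (J.theta x z) = J.theta z x := fun x z =>
    J.injective (by rw [J.map_star, J.map_theta, J.map_theta, star_rankOne])
  have hmul : ∀ x z x' z' : corner Q,
      J.theta x z * J.theta x' z' = J.theta (op (stdInner z.1 x'.1) • x) z' := fun x z x' z' =>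
    J.injective (by rw [J.map_mul, J.map_theta, J.map_theta, J.map_theta, rankOne_mul_rankOne]; rfl)
  have hadd : ∀ x z t : corner Q, J.theta (x + z) t = J.theta x t + J.theta z t := fun x z t =>
    J.injective (by
      rw [map_add, J.map_theta, J.map_theta, J.map_theta]
      ext i j
      simp [rankOne, add_mul])
  -- Each summand is `(x y_k*)(y_k z*) = (x ⟨y_k, y_k⟩) z*`, so the sum collapses by the
  -- normalisation. This identity gives both positivity of `Θ` and (Q).
  have htheta : ∀ x z, J.theta x z = ∑ k, star (J.theta (y k) x) * J.theta (y k) z := fun x z => by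
    simp only [hstar, hmul]
    have h1 : ∑ k, J.theta (op (stdInner (y k).1 (y k).1) • x) z =
        J.theta (∑ k, op (stdInner (y k).1 (y k).1) • x) z :=
      (map_sum (AddMonoidHom.mk' (J.theta · z) fun _ _ => hadd _ _ z) _ _).symm
    rw [h1, ← Finset.sum_smul, ← Finset.op_sum, hy, op_one, one_smul]
  have hsmul : ∀ (c : ℂ⟦X⟧) (x z : Fin n → A), stdInner x (c • z) = c • stdInner x z :=
      fun c x z => by
        simp [stdInner, Finset.smul_sum]
  have hop : ∀ (x z : Fin n → A) (a : A), stdInner x (op a • z) = stdInner x z * a :=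
      fun x z a => by
        simp [stdInner, Finset.sum_mul, mul_assoc]
  have : IsScalarTower ℂ⟦X⟧ B (corner Q) := ⟨fun c b x => Subtype.ext <| by
    rw [hact, map_smul, Matrix.smul_mulVec, ← hact]
    rfl⟩
  have : SMulCommClass B Aᵐᵒᵖ (corner Q) := ⟨fun b a x => Subtype.ext <| by
    rw [hact, Submodule.coe_smul, Submodule.coe_smul, hact, Matrix.mulVec_smul]⟩
  -- The lift only serves to place the bimodule in universe `max u v`.
  refine ⟨ULift.{v} (corner Q), inferInstance, inferInstance, inferInstance, inferInstance,
    inferInstance, inferInstance,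
    ⟨fun b a x => ULift.ext _ _ (smul_comm b a x.down)⟩, ⟨?_⟩⟩
  exact
    { inner := fun x z => stdInner x.down.1 z.down.1
      inner_add_right := fun x z t => by
        simp [stdInner, mul_add, Finset.sum_add_distrib]
      inner_smul_right := fun x c z => hsmul c x.down.1 z.down.1
      inner_op_smul_right := fun x z a => hop x.down.1 z.down.1 a
      star_inner := fun x z => star_stdInner _ _
      inner_self_pos := fun x => IsPositiveElement.sum_star_mul_self _ _
      inner_full := by
        refine eq_top_iff.2 fun a _ => ?_
        have : a = ∑ k, stdInner (y k).1 (op a • (y k).1) := by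
          simp only [hop]
          rw [← Finset.sum_mul, hy, one_mul]
        rw [this]
        exact Submodule.sum_mem _ fun k _ =>
          Submodule.subset_span ⟨ULift.up (y k), ULift.up (op a • y k), rfl⟩
      theta := fun x z => J.theta x.down z.down
      theta_add_left := fun x z t => hadd _ _ _
      theta_smul_left := fun c x z => J.injective (by
        rw [map_smul, J.map_theta, J.map_theta]
        ext i j
        simp [rankOne])
      theta_act_left := fun b x z => J.injective (by
        rw [J.map_mul, J.map_theta, J.map_theta, mul_rankOne, ← hact]
        rfl)
      star_theta := fun x z => hstar _ _
      theta_self_pos := fun x => by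
        rw [htheta]
        exact IsPositiveElement.sum_star_mul_self _ _
      theta_full := by
        refine eq_top_iff.2 fun b _ => ?_
        have hcol : ∀ j, Q *ᵥ Q.col j = Q.col j := fun j => by
          conv_rhs => rw [← J.mul_self]
          rfl
        -- In matrices: `J(b) ∑ (Q e_j)(Q e_j)* = J(b) Q Q* = J(b)`.
        have : b = ∑ j, J.theta (b • ⟨Q.col j, hcol j⟩) ⟨Q.col j, hcol j⟩ := J.injective (by
          simp only [map_sum, J.map_theta, hact, ← mul_rankOne]
          rw [← Finset.mul_sum]
          rw [sum_rankOne_col, J.star_eq, J.mul_self, J.map_mul_self])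
        rw [this]
        exact Submodule.sum_mem _ fun j _ => Submodule.subset_span
          ⟨ULift.up (b • ⟨Q.col j, hcol j⟩), ULift.up ⟨Q.col j, hcol j⟩, rfl⟩
      inner_act := fun x b z => by
        change stdInner x.down.1 (b • z.down).1 = stdInner (star b • x.down).1 z.down.1
        rw [hact, hact, stdInner_mulVec, J.map_star]
      theta_act := fun x a z => J.injective (by
        rw [J.map_theta, J.map_theta]
        ext i j
        simp [rankOne, mul_assoc])
      compat := fun x z t => ULift.ext _ _ <| Subtype.ext <| by
        change (J.theta x.down z.down • t.down).1 = _
        rw [hact, J.map_theta, rankOne_mulVec]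
        rfl
      propertyP := tensorPositive_of_eq_sum (κ := Fin n) (fun k x => x.down.1 k) fun x z => rfl
      propertyQ := tensorPositive_of_eq_sum (fun k x => J.theta (y k) x.down)
        fun x z => htheta _ _ }

end CornerIso
end Corner
end FormalMorita

/-! ### Formal series: division by `λ` -/

namespace FormalSeries

variable {W : Type*}

/-- The series `a_1 + a_2 λ + a_3 λ² + ⋯` of `a`. -/
def shift (a : FormalSeries W) : FormalSeries W := mk fun r => coeff (r + 1) a

@[simp] theorem coeff_shift (r : ℕ) (a : FormalSeries W) : coeff r (shift a) = coeff (r + 1) a := rfl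

variable [AddCommGroup W]

@[simp] theorem coeff_zero_const (w : W) : coeff 0 (const w) = w := rfl

variable [Module ℂ W]

@[simp] theorem coeff_zero_X_smul (a : FormalSeries W) :
    coeff 0 ((PowerSeries.X : ℂ⟦X⟧) • a) = 0 := by
  simp [coeff_smul]

@[simp] theorem coeff_succ_X_smul (r : ℕ) (a : FormalSeries W) :
    coeff (r + 1) ((PowerSeries.X : ℂ⟦X⟧) • a) = coeff r a := by
  rw [coeff_smul, Finset.sum_eq_single (1, r)]
  · simp
  · rintro ⟨i, j⟩ hij hne
    have : i ≠ 1 := by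
      rintro rfl
      rw [Finset.HasAntidiagonal.mem_antidiagonal] at hij
      exact hne (by rw [Prod.mk.injEq]; exact ⟨rfl, by simp only at hij; omega⟩)
    simp [PowerSeries.coeff_X, this]
  · intro h
    exact absurd (Finset.HasAntidiagonal.mem_antidiagonal.2 (Nat.add_comm 1 r)) h

theorem const_add_X_smul_shift (a : FormalSeries W) :
    const (coeff 0 a) + (PowerSeries.X : ℂ⟦X⟧) • shift a = a := by
  ext r
  cases r with
  | zero => simp
  | succ r => simp [const]

theorem X_smul_shift {a : FormalSeries W} (ha : coeff 0 a = 0) :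
    (PowerSeries.X : ℂ⟦X⟧) • shift a = a := by
  ext r
  cases r with
  | zero => simp [ha]
  | succ r => simp

theorem X_smul_injective :
    Function.Injective fun a : FormalSeries W => (PowerSeries.X : ℂ⟦X⟧) • a := fun a b hab => by
  ext r
  simpa using congrArg (coeff (r + 1)) hab

theorem coeff_X_pow_smul_of_lt {r n : ℕ} (h : r < n) (a : FormalSeries W) :
    coeff r ((PowerSeries.X ^ n : ℂ⟦X⟧) • a) = 0 := by
  induction n generalizing r with
  | zero => omega
  | succ n ih =>
    rw [pow_succ', mul_smul]
    cases r with
    | zero => simp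
    | succ r => rw [coeff_succ_X_smul, ih (by omega)]

theorem exists_eq_X_pow_smul {n : ℕ} {a : FormalSeries W} (ha : ∀ r < n, coeff r a = 0) :
    ∃ b : FormalSeries W, a = (PowerSeries.X ^ n : ℂ⟦X⟧) • b := by
  induction n generalizing a with
  | zero => exact ⟨a, by simp⟩
  | succ n ih =>
    obtain ⟨b, hb⟩ := ih (a := shift a) fun r hr => ha (r + 1) (by omega)
    exact ⟨b, by rw [pow_succ', mul_smul, ← hb, X_smul_shift (ha 0 (by omega))]⟩

end FormalSeries

/-! ### Order in `λ` and inverse square roots -/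

namespace FormalMorita

open FormalSeries

/-- The elements of order at least `n` in `λ`. -/
def OrderGE {N : Type*} [AddCommGroup N] [Module ℂ⟦X⟧ N] (n : ℕ) (a : N) : Prop :=
  ∃ b : N, a = (PowerSeries.X ^ n : ℂ⟦X⟧) • b

namespace OrderGE

variable {N : Type*} [AddCommGroup N] [Module ℂ⟦X⟧ N] {m n : ℕ} {a b : N}

theorem add (ha : OrderGE n a) (hb : OrderGE n b) : OrderGE n (a + b) := by
  obtain ⟨a, rfl⟩ := ha
  obtain ⟨b, rfl⟩ := hb
  exact ⟨a + b, by rw [smul_add]⟩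

theorem smul (c : ℂ⟦X⟧) (ha : OrderGE n a) : OrderGE n (c • a) := by
  obtain ⟨a, rfl⟩ := ha
  exact ⟨c • a, smul_comm _ _ _⟩

theorem neg (ha : OrderGE n a) : OrderGE n (-a) := by
  simpa using ha.smul (-1)

theorem mono (h : m ≤ n) (ha : OrderGE n a) : OrderGE m a := by
  obtain ⟨a, rfl⟩ := ha
  exact ⟨(PowerSeries.X ^ (n - m) : ℂ⟦X⟧) • a, by
    rw [smul_smul, ← pow_add, Nat.add_sub_cancel' h]⟩

theorem mul {A : Type*} [Ring A] [Algebra ℂ⟦X⟧ A] {a b : A} (ha : OrderGE m a)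
    (hb : OrderGE n b) : OrderGE (m + n) (a * b) := by
  obtain ⟨a, rfl⟩ := ha
  obtain ⟨b, rfl⟩ := hb
  exact ⟨a * b, by rw [smul_mul_smul_comm, pow_add]⟩

theorem zero_le (a : N) : OrderGE 0 a := ⟨a, by simp⟩

end OrderGE

/-- Approximations of the inverse square root of an element `1 + O(λ)`. -/
noncomputable def invSqrtApprox {A : Type*} [Ring A] [Algebra ℂ⟦X⟧ A] (t : A) : ℕ → A
  | 0 => 1
  | n + 1 => invSqrtApprox t n -
      algebraMap ℂ ℂ⟦X⟧ (1 / 2) • (invSqrtApprox t n * t * invSqrtApprox t n - 1)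

theorem half_add_half {N : Type*} [AddCommGroup N] [Module ℂ⟦X⟧ N] (a : N) :
    algebraMap ℂ ℂ⟦X⟧ (1 / 2) • a + algebraMap ℂ ℂ⟦X⟧ (1 / 2) • a = a := by
  rw [← add_smul, ← map_add, add_halves, map_one, one_smul]

/-- A Newton-type step: near `b = t = 1` a change `δ` of `b` changes `b t b` by about `2δ`, whence
the factor `1/2`. No commutativity is needed. With `e = b t b - 1` of order `n + 1`, the new error
is `½ e(1 - tb) + ½ (1 - bt)e + ¼ e t e`; the factors `1 - tb` and `1 - bt` are `O(λ)`, so each step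
gains at least one order. -/
theorem invSqrtApprox_spec {A : Type*} [Ring A] [Algebra ℂ⟦X⟧ A] {t : A}
    (ht : OrderGE 1 (t - 1)) (n : ℕ) : OrderGE 1 (invSqrtApprox t n - 1) ∧
      OrderGE (n + 1) (invSqrtApprox t n * t * invSqrtApprox t n - 1) := by
  induction n with
  | zero => exact ⟨⟨0, by simp [invSqrtApprox]⟩, by simpa [invSqrtApprox] using ht⟩
  | succ n ih =>
    obtain ⟨h1, h2⟩ := ih
    rw [invSqrtApprox]
    set b := invSqrtApprox t n
    set e := b * t * b - 1 with he
    set c : ℂ⟦X⟧ := algebraMap ℂ ℂ⟦X⟧ (1 / 2)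
    clear_value e
    have hc : ∀ x : A, c • x + c • x = x := half_add_half
    have h3 : OrderGE 1 (1 - t * b) := by
      have : 1 - t * b = -((t - 1) * b + (b - 1)) := by noncomm_ring
      rw [this]
      exact ((ht.mul (OrderGE.zero_le b)).add h1).neg
    have h4 : OrderGE 1 (1 - b * t) := by
      have : 1 - b * t = -(b * (t - 1) + (b - 1)) := by noncomm_ring
      rw [this]
      exact (((OrderGE.zero_le b).mul (ht.mono (le_of_eq (zero_add 1)))).add h1).neg
    refine ⟨?_, ?_⟩
    · have : b - c • e - 1 = (b - 1) + -(c • e) := by abel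
      rw [this]
      exact h1.add ((h2.mono (by omega)).smul c).neg
    · have : (b - c • e) * t * (b - c • e) - 1 =
          c • (e * (1 - t * b)) + c • ((1 - b * t) * e) + (c * c) • (e * t * e) := by
        have h5 : (b - c • e) * t * (b - c • e) - 1 =
            e - c • (e * (t * b)) - c • (b * t * e) + (c * c) • (e * t * e) := by
          have h6 : b * t * b = e + 1 := by rw [he, sub_add_cancel]
          have h7 : (b - c • e) * t * (b - c • e) = b * t * b - c • (e * (t * b)) -
              c • (b * t * e) + (c * c) • (e * t * e) := by
            simp only [sub_mul, mul_sub, smul_mul_assoc, mul_smul_comm, smul_smul, mul_assoc, smul_sub]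
            abel
          rw [h7, h6]
          abel
        rw [h5]
        rw [mul_sub, sub_mul, mul_one, one_mul, smul_sub, smul_sub]
        nth_rewrite 1 [← hc e]
        abel
      rw [this]
      refine (((h2.mul h3).smul c).add ?_).add ?_
      · exact ((h4.mul h2).mono (by omega)).smul c
      · exact (((h2.mul (OrderGE.zero_le t)).mul h2).mono (by omega)).smul _

/-! ### Deformed algebras: classical limit, square roots, equivalence -/

namespace LocalHermitianDeformation

variable {A : Type*} [Ring A] [Algebra ℂ A] [StarRing A] {M : Type*} [HasSupport M A]
  (D : LocalHermitianDeformation A)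

/-- The definition fixes the lowest order only on constant series; by `ℂ[[λ]]`-bilinearity the
higher coefficients of the factors contribute multiples of `λ`. -/
theorem coeff_zero_mul_series (a b : D.Alg) :
    coeff 0 (a * b).series = coeff 0 a.series * coeff 0 b.series := by
  change coeff 0 (D.mul a b) = coeff 0 (a : FormalSeries A) * coeff 0 (b : FormalSeries A)
  have ha : (a : FormalSeries A) = const (coeff 0 a.series) + (PowerSeries.X : ℂ⟦X⟧) • shift a :=
    (const_add_X_smul_shift _).symm
  have hb : (b : FormalSeries A) = const (coeff 0 b.series) + (PowerSeries.X : ℂ⟦X⟧) • shift b :=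
    (const_add_X_smul_shift _).symm
  rw [ha, hb]
  simp [D.coeff_zero_mul]

theorem orderGE_iff {n : ℕ} (a : D.Alg) : OrderGE n a ↔ ∀ r < n, coeff r a.series = 0 := by
  constructor
  · rintro ⟨b, rfl⟩ r hr
    exact coeff_X_pow_smul_of_lt hr b.series
  · intro h
    exact exists_eq_X_pow_smul h

theorem star_invSqrtApprox [StarModule ℂ A] {t : D.Alg} (ht : star t = t) (n : ℕ) :
    star (invSqrtApprox t n) = invSqrtApprox t n := by
  have hc : star (algebraMap ℂ ℂ⟦X⟧ (1 / 2)) = algebraMap ℂ ℂ⟦X⟧ (1 / 2) := by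
    ext r
    rw [coeff_star, PowerSeries.algebraMap_apply, PowerSeries.coeff_C]
    split_ifs <;> simp
  induction n with
  | zero => simp [invSqrtApprox]
  | succ n ih =>
    rw [invSqrtApprox, star_sub, star_smul, hc, star_sub, StarMul.star_mul, StarMul.star_mul,
      ih, ht, star_one, _root_.mul_assoc]

/-- Hermitian deformations of `1` have Hermitian inverse square roots. -/
theorem exists_invSqrt [StarModule ℂ A] {t : D.Alg} (ht : star t = t)
    (ht0 : coeff 0 t.series = 1) : ∃ b : D.Alg, star b = b ∧ b * t * b = 1 := by
  have ht1 : OrderGE 1 (t - 1) := (D.orderGE_iff _).2 fun r hr => by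
    obtain rfl : r = 0 := by omega
    change coeff 0 t.series - coeff 0 (const 1) = 0
    rw [ht0, coeff_zero_const, sub_self]
  have hspec := invSqrtApprox_spec ht1
  set s : ℕ → D.Alg := invSqrtApprox t
  have hstep : ∀ n, OrderGE (n + 1) (s (n + 1) - s n) := fun n => by
    have : s (n + 1) - s n = -(algebraMap ℂ ℂ⟦X⟧ (1 / 2) • (s n * t * s n - 1)) := by
      change (s n - algebraMap ℂ ℂ⟦X⟧ (1 / 2) • (s n * t * s n - 1)) - s n = _
      abel
    rw [this]
    exact ((hspec n).2.smul _).neg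
  have hstab : ∀ n r, coeff r (s (r + n)).series = coeff r (s r).series := fun n r => by
    induction n with
    | zero => rfl
    | succ n ih =>
      rw [← ih]
      exact sub_eq_zero.1 ((D.orderGE_iff _).1 (hstep (r + n)) r (by omega))
  -- The `λ`-adic limit: coefficient `r` no longer changes from the `r`-th approximation on.
  set b : D.Alg := D.ofSeries (FormalSeries.mk fun r => coeff r (s r).series)
  have hb : ∀ n, OrderGE (n + 1) (b - s n) := fun n => (D.orderGE_iff _).2 fun r hr => by
    change coeff r (s r).series - coeff r (s n).series = 0
    rw [sub_eq_zero, ← hstab (n - r) r, Nat.add_sub_cancel' (by omega)]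
  refine ⟨b, FormalSeries.ext fun r => ?_, sub_eq_zero.1 (FormalSeries.ext fun r => ?_)⟩
  · change star (coeff r (s r).series) = coeff r (s r).series
    exact congrArg (fun a : D.Alg => coeff r a.series) (D.star_invSqrtApprox ht r)
  -- Replacing `b` by `s r` one factor at a time costs only terms of order `r + 1`.
  · have h1 : b * t * b - 1 = ((b - s r) * (t * b) + (s r * t) * (b - s r)) + (s r * t * s r - 1) := by
      noncomm_ring
    have h2 : OrderGE (r + 1) (b * t * b - 1) := by
      rw [h1]
      exact (((hb r).mul (OrderGE.zero_le _)).add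
        (((OrderGE.zero_le _).mul (hb r)).mono (by omega))).add (hspec r).2
    exact (D.orderGE_iff _).1 h2 r (by omega)

/-- Equality in the quotient yields a chain of equivalences, traversed in either direction. Each
link is a `*`-isomorphism, and these invert and compose. -/
theorem nonempty_starAlgEquiv_of_mk_eq {D₁ D₂ : LocalHermitianDeformation A}
    (h : DefStar.mk D₁ = DefStar.mk D₂) : Nonempty (D₁.Alg ≃⋆ₐ[ℂ⟦X⟧] D₂.Alg) := by
  have h' : Relation.EqvGen Equivalent D₁ D₂ := Quot.eqvGen_exact h
  clear h
  induction h' with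
  | rel D₁ D₂ h =>
    obtain ⟨T, hT⟩ := h
    exact ⟨{ T.toEquiv with
      map_mul' := hT
      map_star' := T.map_star
      map_smul' := T.toEquiv.map_smul }⟩
  | refl D => exact ⟨StarAlgEquiv.refl _ _⟩
  | symm D₁ D₂ _ ih => exact ih.map StarAlgEquiv.symm
  | trans D₁ D₂ D₃ _ _ ih₁ ih₂ =>
    exact ih₁.elim fun e₁ => ih₂.map fun e₂ => e₁.trans e₂

end LocalHermitianDeformation

end FormalMorita

namespace FormalMorita

/-! ### Frames of sections and `Γ^∞(End V) = P₀ M_n(𝒜) P₀` -/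

section Geometry

open Bundle Matrix

variable {d : ℕ} {M : Type*} [TopologicalSpace M] [ChartedSpace (EuclideanSpace ℝ (Fin d)) M]
  {F : Type*} [NormedAddCommGroup F] [NormedSpace ℂ F]
  {V : M → Type*} [TopologicalSpace (TotalSpace F V)]
  [∀ x, AddCommGroup (V x)] [∀ x, Module ℂ (V x)] [∀ x, TopologicalSpace (V x)]
  [FiberBundle F V] [VectorBundle ℂ F V] [VectorBundle ℝ F V] [ContMDiffVectorBundle ∞ F V (𝓡 d)]

/-- Every vector is the value of a global smooth section. -/
theorem Sections.exists_apply_eq [FiniteDimensional ℂ F] [T2Space M] [SecondCountableTopology M]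
    [IsManifold (𝓡 d) ∞ M] (x : M) (v : V x) : ∃ s : Sections d F V, s.1 x = v := by
  classical
  have : LocallyCompactSpace M := ChartedSpace.locallyCompactSpace (EuclideanSpace ℝ (Fin d)) M
  -- A partition of unity argument: the convex constraint is `{v}` at `x` and the whole fibre
  -- elsewhere. Local solutions are an extension of `v` near `x`, and zero on the complement of `x`.
  obtain ⟨s, hs⟩ := exists_contMDiffSection_forall_mem_convex_of_local (𝓡 d) (n := ⊤)
    (F_fiber := F) V (fun y => {w | ∀ hy : x = y, w = hy ▸ v})
    (fun y => by
      by_cases hy : x = y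
      · subst hy
        simp
      · simpa [hy] using convex_univ)
    (fun y => by
      by_cases hy : x = y
      · subst hy
        obtain ⟨U, hU, hs⟩ := FiberBundle.exists_contMDiffOn_extend (𝕜 := ℝ) (𝓡 d) F (k := ∞) v
        refine ⟨U, hU, FiberBundle.extend F v, hs, fun z _ hz => ?_⟩
        subst hz
        exact FiberBundle.extend_apply_self F v
      · exact ⟨{x}ᶜ, isOpen_compl_singleton.mem_nhds (Ne.symm hy), fun _ => 0,
          (contMDiff_zeroSection ℝ V).contMDiffOn, fun z hz hz' => absurd hz'.symm hz⟩)
  exact ⟨⟨s, s.contMDiff.contMDiffOn⟩, hs x rfl⟩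

variable [FiniteDimensional ℂ F] {h : HermitianMetric d F V}

/-- The rank one endomorphism field `h(t, ·) s`. -/
def rankOneField (h : HermitianMetric d F V) (s t : Sections d F V) :
    EndSections h :=
  ⟨fun x => LinearMap.smulRight
      { toFun := h.form x (t.1 x)
        map_add' := h.add_right x (t.1 x)
        map_smul' := fun c w => h.smul_right x (t.1 x) c w } (s.1 x),
    fun U hU r hr => SmoothSectionOn.smul
      (h.smooth U hU t.1 r (t.2.mono (Set.subset_univ U)) hr) (s.2.mono (Set.subset_univ U))⟩

namespace Presentation

variable (p : Presentation h)

/-- The generators of `Γ^∞(V)` given by the columns of `P₀`. -/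
noncomputable def gen (j : Fin p.n) : Sections d F V :=
  p.equiv.symm (p.P.mulVecLin.rangeRestrict (Pi.single j 1))

theorem equiv_gen (i j : Fin p.n) : (p.equiv (p.gen j)).1 i = p.P i j := by
  simp [gen]

theorem P_mulVec_equiv (s : Sections d F V) : p.P *ᵥ (p.equiv s).1 = (p.equiv s).1 := by
  obtain ⟨x, hx⟩ := (p.equiv s).2
  rw [← hx, Matrix.mulVecLin_apply, Matrix.mulVec_mulVec, p.P_mul_P]

theorem equiv_apply (s : Sections d F V) (i : Fin p.n) :
    (p.equiv s).1 i = h.pairing (p.gen i) s := by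
  have h1 : (star p.P *ᵥ (p.equiv s).1) i = (p.equiv s).1 i := by
    rw [p.star_P, p.P_mulVec_equiv]
  rw [← p.isometry, ← h1]
  simp only [Matrix.mulVec, dotProduct, Matrix.star_apply, equiv_gen]

theorem matrix_apply (T : EndSections h) (i j : Fin p.n) :
    p.matrix T i j = h.pairing (p.gen i) (T.act (p.gen j)) :=
  p.equiv_apply _ i

theorem pairing_gen (i j : Fin p.n) : h.pairing (p.gen i) (p.gen j) = p.P i j := by
  rw [← p.equiv_apply, p.equiv_gen]

/-- The columns of `P₀` form a Parseval frame: this is `P₀ s = s`, the coordinates of `s` being its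
pairings with the columns. -/
theorem sum_pairing_smul_gen (s : Sections d F V) :
    ∑ j, h.pairing (p.gen j) s • p.gen j = s := by
  apply p.equiv.injective
  ext1
  funext i
  simp only [map_sum, map_smul, AddSubmonoidClass.coe_finsetSum, Submodule.coe_smul,
    Finset.sum_apply, Pi.smul_apply, equiv_gen, smul_eq_mul, ← p.equiv_apply]
  conv_rhs => rw [← p.P_mulVec_equiv s]
  exact Finset.sum_congr rfl fun j _ => mul_comm _ _

theorem sum_form_smul_gen [T2Space M] [SecondCountableTopology M] [IsManifold (𝓡 d) ∞ M]
    (x : M) (v : V x) : ∑ j, h.form x ((p.gen j).1 x) v • (p.gen j).1 x = v := by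
  obtain ⟨s, rfl⟩ := Sections.exists_apply_eq (d := d) (F := F) x v
  conv_rhs => rw [← p.sum_pairing_smul_gen s]
  simp only [AddSubmonoidClass.coe_finsetSum, Finset.sum_apply]
  rfl

/-- `p.matrix` as a linear map. -/
noncomputable def matrixLinear :
    EndSections h →ₗ[ℂ] Matrix (Fin p.n) (Fin p.n) (SmoothFun d M) where
  toFun := p.matrix
  map_add' T S := by
    ext i j x
    simp only [matrix_apply, Matrix.add_apply]
    exact h.add_right x _ _ _
  map_smul' c T := by
    ext i j x
    simp only [matrix_apply, Matrix.smul_apply]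
    exact h.smul_right x _ _ _

theorem matrix_star (T : EndSections h) : p.matrix (star T) = star (p.matrix T) := by
  ext i j x
  simp only [Matrix.star_apply, matrix_apply]
  change h.form x ((p.gen i).1 x) (h.adjoint x (T.fib x) ((p.gen j).1 x)) =
    starRingEnd ℂ (h.form x ((p.gen j).1 x) (T.fib x ((p.gen i).1 x)))
  rw [h.form_adjoint_right, h.conj_symm]

theorem P_mul_matrix (T : EndSections h) : p.P * p.matrix T = p.matrix T := by
  ext1 i j
  exact congrFun (p.P_mulVec_equiv (T.act (p.gen j))) i

theorem matrix_mul_P (T : EndSections h) : p.matrix T * p.P = p.matrix T := by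
  have h1 := congrArg star (p.P_mul_matrix (star T))
  rwa [p.matrix_star, StarMul.star_mul, star_star, p.star_P] at h1

/-- The matrix determines the field on the generators, and their values span every fibre. -/
theorem matrix_injective [T2Space M] [SecondCountableTopology M] [IsManifold (𝓡 d) ∞ M] :
    Function.Injective p.matrix := by
  intro T S hTS
  have h1 : ∀ j, T.act (p.gen j) = S.act (p.gen j) := fun j => by
    rw [← p.sum_pairing_smul_gen (T.act (p.gen j)), ← p.sum_pairing_smul_gen (S.act (p.gen j))]
    simp only [← p.matrix_apply, hTS]
  refine EndSections.ext fun x v => ?_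
  rw [← p.sum_form_smul_gen x v, map_sum, map_sum]
  refine Finset.sum_congr rfl fun j _ => ?_
  rw [map_smul, map_smul]
  exact congrArg _ (congrFun (congrArg Subtype.val (h1 j)) x)

theorem exists_matrix_eq {L : Matrix (Fin p.n) (Fin p.n) (SmoothFun d M)}
    (hL : p.P * L * p.P = L) : ∃ T, p.matrix T = L := by
  -- Since the generators have Gram matrix `P₀`, this field has matrix `P₀ L P₀`.
  refine ⟨∑ k, ∑ l, rankOneField h (L k l • p.gen k) (p.gen l), ?_⟩
  have h1 : ∀ s t i j, p.matrix (rankOneField h s t) i j =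
      h.pairing (p.gen i) s * h.pairing t (p.gen j) := fun s t i j => by
    rw [p.matrix_apply]
    refine Subtype.ext (funext fun x => ?_)
    exact (h.smul_right x _ _ _).trans (mul_comm _ _)
  have h2 : ∀ i (f : SmoothFun d M) k, h.pairing (p.gen i) (f • p.gen k) = f * p.P i k :=
    fun i f k => by
      rw [← p.pairing_gen]
      refine Subtype.ext (funext fun x => ?_)
      exact h.smul_right x _ _ _
  change p.matrixLinear _ = L
  rw [map_sum]
  simp only [map_sum]
  ext1 i j
  conv_rhs => rw [← hL]
  simp only [Matrix.sum_apply, Matrix.mul_apply, Finset.sum_mul]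
  rw [Finset.sum_comm]
  refine Finset.sum_congr rfl fun l _ => Finset.sum_congr rfl fun k _ => ?_
  change p.matrix (rankOneField h (L k l • p.gen k) (p.gen l)) i j = _
  rw [h1, h2, p.pairing_gen, mul_comm (L k l)]

/-- At each point, take the trace of the frame decomposition `id = ∑ h(g_j, ·) g_j`: the `j`-th term
has trace `h(g_j, g_j) = (P₀)_jj`. -/
theorem trace_P [T2Space M] [SecondCountableTopology M] [IsManifold (𝓡 d) ∞ M] :
    ∑ j, p.P j j = algebraMap ℂ (SmoothFun d M) (Module.finrank ℂ F) := by
  refine Subtype.ext (funext fun x => ?_)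
  let φ : V x → Module.Dual ℂ (V x) := fun u =>
    { toFun := h.form x u
      map_add' := h.add_right x u
      map_smul' := fun c w => h.smul_right x u c w }
  let e := (trivializationAt F V x).linearEquivAt ℂ x
    (FiberBundle.mem_baseSet_trivializationAt' x)
  have : FiniteDimensional ℂ (V x) := e.symm.finiteDimensional
  have h1 : ∑ j, (φ ((p.gen j).1 x)).smulRight ((p.gen j).1 x) = LinearMap.id :=
    LinearMap.ext fun v => by
      rw [LinearMap.sum_apply]
      exact p.sum_form_smul_gen x v
  have h2 := congrArg (LinearMap.trace ℂ (V x)) h1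
  rw [map_sum, LinearMap.trace_id, e.finrank_eq] at h2
  simp only [LinearMap.trace_smulRight] at h2
  simp only [← p.pairing_gen, AddSubmonoidClass.coe_finsetSum, Finset.sum_apply]
  exact h2

end Presentation
end Geometry
end FormalMorita

namespace FormalMorita

open FormalSeries Matrix MulOpposite

namespace CornerIso

/-- Transport of a corner isomorphism along `*`-isomorphisms. -/
noncomputable def congr {A A' : Type*} [Ring A] [Algebra ℂ⟦X⟧ A] [StarRing A]
    [Ring A'] [Algebra ℂ⟦X⟧ A'] [StarRing A'] {B B' : Type*} [Ring B] [Algebra ℂ⟦X⟧ B] [StarRing B]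
    [Ring B'] [Algebra ℂ⟦X⟧ B'] [StarRing B'] {n : ℕ} {Q : Matrix (Fin n) (Fin n) A}
    (J : CornerIso B Q) (e : A ≃⋆ₐ[ℂ⟦X⟧] A') (f : B' ≃⋆ₐ[ℂ⟦X⟧] B) : CornerIso B' (Q.map e) where
  toLinearMap :=
    { toFun := fun b => (J.toLinearMap (f b)).map e
      map_add' := fun a b => by
        ext i j
        simp
      map_smul' := fun c b => by
        ext i j
        simp [map_smul] }
  map_one := by
    change (J.toLinearMap (f 1)).map e = _
    rw [_root_.map_one f, J.map_one]
  map_mul a b := by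
    change (J.toLinearMap (f (a * b))).map e =
      (J.toLinearMap (f a)).map e * (J.toLinearMap (f b)).map e
    rw [_root_.map_mul f, J.map_mul, Matrix.map_mul]
  map_star b := by
    change (J.toLinearMap (f (star b))).map e = star ((J.toLinearMap (f b)).map e)
    rw [StarHomClass.map_star f, J.map_star]
    ext i j
    simp [Matrix.star_apply, StarHomClass.map_star]
  injective a b hab := f.injective (J.injective (Matrix.map_injective e.injective hab))
  exists_eq L hL := by
    obtain ⟨b, hb⟩ := J.exists_eq (L.map e.symm) (by
      have h1 := congrArg (fun L : Matrix (Fin n) (Fin n) A' => L.map e.symm) hL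
      simp only [Matrix.map_mul, Matrix.map_map] at h1
      have h2 : Q.map (e.symm ∘ e) = Q := by
        ext i j
        simp
      rwa [h2] at h1)
    refine ⟨f.symm b, ?_⟩
    change (J.toLinearMap (f (f.symm b))).map e = L
    rw [f.apply_symm_apply, hb]
    ext i j
    simp

theorem stdInner_map {A A' : Type*} [Ring A] [Algebra ℂ⟦X⟧ A] [StarRing A]
    [Ring A'] [Algebra ℂ⟦X⟧ A'] [StarRing A'] (e : A ≃⋆ₐ[ℂ⟦X⟧] A') {n : ℕ} (x y : Fin n → A) :
    stdInner (fun i => e (x i)) (fun i => e (y i)) = e (stdInner x y) := by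
  simp [stdInner, map_sum, _root_.map_mul, StarHomClass.map_star]

end CornerIso

/-- The classical limit of a deformed algebra. -/
def LocalHermitianDeformation.classicalLimit {A : Type*} [Ring A] [Algebra ℂ A] [StarRing A]
    {M : Type*} [HasSupport M A] (D : LocalHermitianDeformation A) : D.Alg →+* A where
  toFun a := coeff 0 a.series
  map_one' := rfl
  map_mul' := D.coeff_zero_mul_series
  map_zero' := rfl
  map_add' _ _ := rfl

theorem coeff_zero_smul {W : Type*} [AddCommGroup W] [Module ℂ W] (c : ℂ⟦X⟧) (a : FormalSeries W) :
    coeff 0 (c • a) = PowerSeries.coeff 0 c • coeff 0 a := by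
  simp [coeff_smul]

section Phi

/-! ### The map `I` and the deformed corner -/

open Bundle HasSupport

variable {d : ℕ} {M : Type*} [TopologicalSpace M] [ChartedSpace (EuclideanSpace ℝ (Fin d)) M]
  {F : Type*} [NormedAddCommGroup F] [NormedSpace ℂ F] [FiniteDimensional ℂ F]
  {V : M → Type*} [TopologicalSpace (TotalSpace F V)]
  [∀ x, AddCommGroup (V x)] [∀ x, Module ℂ (V x)] [∀ x, TopologicalSpace (V x)]
  [FiberBundle F V] [VectorBundle ℂ F V] [VectorBundle ℝ F V] [ContMDiffVectorBundle ∞ F V (𝓡 d)]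
  {h : HermitianMetric d F V} {D : LocalHermitianDeformation (SmoothFun d M)}

/-- The `λ`-linear extension of `p.matrix`. -/
noncomputable def Presentation.seriesMatrix (p : Presentation h)
    (D : LocalHermitianDeformation (SmoothFun d M)) :
    FormalSeries (EndSections h) →ₗ[ℂ⟦X⟧] Matrix (Fin p.n) (Fin p.n) D.Alg where
  toFun b := Matrix.of fun i j => D.ofSeries (FormalSeries.mk fun r => p.matrix (coeff r b) i j)
  map_add' a b := by
    ext1 i j
    refine FormalSeries.ext fun r => ?_
    exact congrFun (congrFun (p.matrixLinear.map_add (coeff r a) (coeff r b)) i) j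
  map_smul' c b := by
    ext1 i j
    refine FormalSeries.ext fun r => ?_
    change p.matrixLinear (coeff r (c • b)) i j =
      coeff r (c • (FormalSeries.mk fun r => p.matrixLinear (coeff r b) i j))
    simp only [coeff_smul, map_sum, map_smul, Matrix.sum_apply, Matrix.smul_apply, coeff_mk]

namespace DeformedProjection

variable {p : Presentation h} (Q : DeformedProjection p D)

/-- The map `I` as a linear map. -/
noncomputable def linearI :
    FormalSeries (EndSections h) →ₗ[ℂ⟦X⟧] Matrix (Fin p.n) (Fin p.n) D.Alg :=
  LinearMap.mulRight ℂ⟦X⟧ Q.Q ∘ₗ LinearMap.mulLeft ℂ⟦X⟧ Q.Q ∘ₗ p.seriesMatrix D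

theorem map_classicalLimit_Q : Q.Q.map D.classicalLimit = p.P :=
  Matrix.ext Q.coeff_zero

theorem map_classicalLimit_I (b : FormalSeries (EndSections h)) :
    (Q.linearI b).map D.classicalLimit = p.matrix (coeff 0 b) := by
  have h1 : (p.seriesMatrix D b).map D.classicalLimit = p.matrix (coeff 0 b) := rfl
  change (Q.Q * p.seriesMatrix D b * Q.Q).map D.classicalLimit = _
  rw [Matrix.map_mul, Matrix.map_mul, h1, Q.map_classicalLimit_Q, p.P_mul_matrix, p.matrix_mul_P]

theorem I_star (b : FormalSeries (EndSections h)) : Q.I (star b) = star (Q.I b) := by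
  have h1 : p.seriesMatrix D (star b) = star (p.seriesMatrix D b) := by
    ext1 i j
    refine FormalSeries.ext fun r => ?_
    exact congrFun (congrFun (p.matrix_star (coeff r b)) i) j
  change Q.Q * p.seriesMatrix D (star b) * Q.Q = star (Q.Q * p.seriesMatrix D b * Q.Q)
  rw [h1, star_mul, star_mul, Q.star_Q, mul_assoc]

theorem Q_mul_linearI_mul_Q (b : FormalSeries (EndSections h)) :
    Q.Q * Q.linearI b * Q.Q = Q.linearI b := by
  change Q.Q * (Q.Q * p.seriesMatrix D b * Q.Q) * Q.Q = Q.Q * p.seriesMatrix D b * Q.Q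
  calc _ = Q.Q * Q.Q * p.seriesMatrix D b * (Q.Q * Q.Q) := by simp only [mul_assoc]
    _ = _ := by rw [Q.Q_mul_Q]

theorem X_smul_matrix_injective {n : ℕ} :
    Function.Injective fun L : Matrix (Fin n) (Fin n) D.Alg => (PowerSeries.X : ℂ⟦X⟧) • L :=
  fun _ _ hL => Matrix.ext fun i j => X_smul_injective (congrFun (congrFun hL i) j)

/-- The classical limit of `I b` is the matrix of `b₀`, so `I b = 0` forces `b₀ = 0`. Then `b = λ ·
shift b`, and cancelling `λ` allows induction on the coefficient. -/
theorem I_injective [T2Space M] [SecondCountableTopology M] [IsManifold (𝓡 d) ∞ M] :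
    Function.Injective Q.I := by
  change Function.Injective Q.linearI
  rw [injective_iff_map_eq_zero]
  have h0 : ∀ b, Q.linearI b = 0 → coeff 0 b = 0 := fun b hb => by
    refine p.matrix_injective ?_
    rw [← Q.map_classicalLimit_I, hb]
    exact p.matrixLinear.map_zero.symm
  have hr : ∀ r b, Q.linearI b = 0 → coeff r b = 0 := fun r => by
    induction r with
    | zero => exact h0
    | succ r ih =>
      intro b hb
      refine ih (shift b) (X_smul_matrix_injective ?_)
      change (PowerSeries.X : ℂ⟦X⟧) • Q.linearI (shift b) = (PowerSeries.X : ℂ⟦X⟧) • 0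
      rw [← map_smul, X_smul_shift (h0 b hb), hb, smul_zero]
  exact fun b hb => FormalSeries.ext fun r => hr r b hb

/-- One order of surjectivity: matching classical limits leaves a remainder divisible by `λ`, whose
quotient stays in the corner because `λ` can be cancelled. -/
theorem exists_step {L : Matrix (Fin p.n) (Fin p.n) D.Alg} (hL : Q.Q * L * Q.Q = L) :
    ∃ (b : EndSections h) (L' : Matrix (Fin p.n) (Fin p.n) D.Alg),
      Q.Q * L' * Q.Q = L' ∧ L = Q.linearI (const b) + (PowerSeries.X : ℂ⟦X⟧) • L' := by
  obtain ⟨b, hb⟩ := p.exists_matrix_eq (L := L.map D.classicalLimit) (by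
    rw [← Q.map_classicalLimit_Q, ← Matrix.map_mul, ← Matrix.map_mul, hL])
  have h0 : (L - Q.linearI (const b)).map D.classicalLimit = 0 := by
    rw [Matrix.map_sub _ (map_sub D.classicalLimit), Q.map_classicalLimit_I, coeff_zero_const,
      hb, sub_self]
  let L' : Matrix (Fin p.n) (Fin p.n) D.Alg :=
    Matrix.of fun i j => D.ofSeries (shift ((L - Q.linearI (const b)) i j).series)
  have h1 : (PowerSeries.X : ℂ⟦X⟧) • L' = L - Q.linearI (const b) :=
    Matrix.ext fun i j => X_smul_shift (congrFun (congrFun h0 i) j)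
  refine ⟨b, L', X_smul_matrix_injective ?_, by rw [h1, add_sub_cancel]⟩
  change (PowerSeries.X : ℂ⟦X⟧) • (Q.Q * L' * Q.Q) = (PowerSeries.X : ℂ⟦X⟧) • L'
  rw [← smul_mul_assoc, ← mul_smul_comm, h1, mul_sub, sub_mul, hL,
    Q.Q_mul_linearI_mul_Q]

theorem exists_I_eq {L : Matrix (Fin p.n) (Fin p.n) D.Alg} (hL : Q.Q * L * Q.Q = L) :
    ∃ b, Q.I b = L := by
  choose! b next hnext hstep using fun L => Q.exists_step (L := L)
  -- The coefficients of the preimage are read off from the iterated remainders. The error for `L`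
  -- is `λ` times the error for `next L`, so it vanishes to every order.
  let s : Matrix (Fin p.n) (Fin p.n) D.Alg → FormalSeries (EndSections h) :=
    fun L => FormalSeries.mk fun r => b (next^[r] L)
  have hs : ∀ L, s L = const (b L) + (PowerSeries.X : ℂ⟦X⟧) • s (next L) :=
    fun L => (const_add_X_smul_shift (s L)).symm
  have key : ∀ r L, Q.Q * L * Q.Q = L →
      ∀ i j, coeff r ((Q.linearI (s L) - L) i j).series = 0 := fun r => by
    have hdiff : ∀ L, Q.Q * L * Q.Q = L →
        Q.linearI (s L) - L = (PowerSeries.X : ℂ⟦X⟧) • (Q.linearI (s (next L)) - next L) :=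
      fun L hL => by
        have h1 : Q.linearI (s L) = Q.linearI (const (b L)) +
            (PowerSeries.X : ℂ⟦X⟧) • Q.linearI (s (next L)) := by
          rw [← map_smul, ← map_add, ← hs L]
        rw [h1, smul_sub, sub_eq_sub_iff_add_eq_add]
        rw [add_right_comm, ← hstep L hL, add_comm]
    induction r with
    | zero =>
      intro L hL i j
      rw [hdiff L hL]
      exact coeff_zero_X_smul _
    | succ r ih =>
      intro L hL i j
      rw [hdiff L hL]
      exact (coeff_succ_X_smul r _).trans (ih _ (hnext L hL) i j)
  exact ⟨s L, sub_eq_zero.1 (Matrix.ext fun i j => FormalSeries.ext fun r => key r L hL i j)⟩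

/-- The isomorphism with `𝐏 ⋆ M_n(𝐀) ⋆ 𝐏` of a deformation of `Γ^∞(End(V))` representing
`Φ([⋆])`. -/
noncomputable def cornerIso [T2Space M] [SecondCountableTopology M] [IsManifold (𝓡 d) ∞ M]
    {D' : LocalHermitianDeformation (EndSections h)} (T : FormalTransformation (EndSections h))
    (hT : ∀ a b, Q.I (T.toEquiv (D'.mul a b)) = Q.I (T.toEquiv a) * Q.I (T.toEquiv b)) :
    CornerIso D'.Alg Q.Q :=
  let J : D'.Alg →ₗ[ℂ⟦X⟧] Matrix (Fin p.n) (Fin p.n) D.Alg := Q.linearI ∘ₗ T.toEquiv.toLinearMap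
  have hmul : ∀ a b : D'.Alg, J (a * b) = J a * J b := hT
  have hsurj : ∀ L, Q.Q * L * Q.Q = L → ∃ b, J b = L := fun L hL => by
    obtain ⟨b, hb⟩ := Q.exists_I_eq hL
    exact ⟨T.toEquiv.symm b, (congrArg Q.I (T.toEquiv.apply_symm_apply b)).trans hb⟩
  { toLinearMap := J
    map_one := by
      -- The unit is forced: with `𝐏 = J b`, multiplicativity gives `𝐏 J(1) = 𝐏`, while `J(1) = 𝐏
      -- J(1) 𝐏`.
      obtain ⟨b, hb⟩ := hsurj Q.Q (by rw [Q.Q_mul_Q, Q.Q_mul_Q])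
      have h1 : Q.Q * J 1 * Q.Q = J 1 := Q.Q_mul_linearI_mul_Q _
      have h2 : J 1 * Q.Q = Q.Q := by rw [← hb, ← hmul, one_mul]
      have h3 : Q.Q * J 1 = Q.Q := by rw [← hb, ← hmul, mul_one]
      rw [← h1, h3, Q.Q_mul_Q]
    map_mul := hmul
    map_star := fun b => (congrArg Q.I (T.map_star b)).trans (Q.I_star _)
    injective := Q.I_injective.comp T.toEquiv.injective
    exists_eq := hsurj }

/-- The module `𝐏 ⋆ 𝐀^n` contains a normalised family. -/
theorem exists_normalised [T2Space M] [SecondCountableTopology M] [IsManifold (𝓡 d) ∞ M]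
    [Nontrivial F] : ∃ y : Fin p.n → corner Q.Q, ∑ k, stdInner (y k).1 (y k).1 = 1 := by
  have hk : (0 : ℝ) < Module.finrank ℂ F := Nat.cast_pos.2 Module.finrank_pos
  set k : ℝ := (Module.finrank ℂ F : ℝ) with hkdef
  -- Scaling the columns by `k^{-1/2}` makes the classical limit of their summed squares `k⁻¹ tr P₀
  -- = 1`; this is where positive rank enters.
  let c : ℂ⟦X⟧ := PowerSeries.C (((Real.sqrt k)⁻¹ : ℝ) : ℂ)
  have hc : star c = c := by
    ext r
    rw [coeff_star, PowerSeries.coeff_C]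
    split_ifs <;> simp
  have hcol : ∀ j, stdInner (Q.Q.col j) (Q.Q.col j) = Q.Q j j := fun j => by
    have h1 : (star Q.Q * Q.Q) j j = Q.Q j j := by rw [Q.star_Q, Q.Q_mul_Q]
    rw [← h1]
    rfl
  let t : D.Alg := (c * c) • ∑ j, Q.Q j j
  have ht : star t = t := by
    have h1 : ∀ j, star (Q.Q j j) = Q.Q j j := fun j => congrFun (congrFun Q.star_Q j) j
    simp only [t, star_smul, star_sum, h1, star_mul, hc]
  have ht0 : coeff 0 t.series = 1 := by
    have h1 : coeff 0 (∑ j, Q.Q j j : D.Alg).series = ∑ j, p.P j j := by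
      change D.classicalLimit (∑ j, Q.Q j j) = _
      rw [map_sum]
      exact Finset.sum_congr rfl fun j _ => Q.coeff_zero j j
    refine (coeff_zero_smul (c * c) (∑ j, Q.Q j j : D.Alg).series).trans ?_
    have h2 : PowerSeries.coeff 0 (c * c) * (Module.finrank ℂ F : ℂ) = 1 := by
      have h3 : (Real.sqrt k)⁻¹ * (Real.sqrt k)⁻¹ * k = 1 := by
        rw [← mul_inv, Real.mul_self_sqrt hk.le, inv_mul_cancel₀ hk.ne']
      rw [← map_mul, PowerSeries.coeff_C, if_pos rfl]
      exact_mod_cast congrArg Complex.ofReal h3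
    rw [h1, p.trace_P, Algebra.algebraMap_eq_smul_one, smul_smul, h2, one_smul]
  obtain ⟨b, hb, hbt⟩ := D.exists_invSqrt ht ht0
  have hmem : ∀ j, Q.Q *ᵥ Q.Q.col j = Q.Q.col j := fun j => by
    conv_rhs => rw [← Q.Q_mul_Q]
    rfl
  -- Right multiplication by the Hermitian `b` conjugates the sum of squares `t` to `b t b = 1`.
  refine ⟨fun j => c • op b • ⟨Q.Q.col j, hmem j⟩, ?_⟩
  have h1 : ∀ j, stdInner (c • op b • Q.Q.col j) (c • op b • Q.Q.col j) =
      b * ((c * c) • Q.Q j j) * b := fun j => by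
    rw [← hcol]
    simp [stdInner, hc, hb, Finset.mul_sum, Finset.sum_mul, Finset.smul_sum, mul_assoc, smul_smul]
  refine (Finset.sum_congr rfl fun j _ => h1 j).trans ?_
  rw [← Finset.sum_mul, ← Finset.mul_sum, ← Finset.smul_sum]
  exact hbt

end DeformedProjection

end Phi
end FormalMorita

theorem mainTheorem7 {d : ℕ} {M : Type u} [TopologicalSpace M] [T2Space M]
    [SecondCountableTopology M] [ChartedSpace (EuclideanSpace ℝ (Fin d)) M] [IsManifold (𝓡 d) ∞ M]
    {F : Type t} [NormedAddCommGroup F] [NormedSpace ℂ F] [FiniteDimensional ℂ F] [Nontrivial F]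
    {V : M → Type v} [TopologicalSpace (Bundle.TotalSpace F V)]
    [∀ x, AddCommGroup (V x)] [∀ x, Module ℂ (V x)] [∀ x, TopologicalSpace (V x)]
    [FiberBundle F V] [VectorBundle ℂ F V] [VectorBundle ℝ F V]
    [ContMDiffVectorBundle ∞ F V (𝓡 d)]
    (h : HermitianMetric d F V)
    (D : LocalHermitianDeformation (SmoothFun d M))
    (D' : LocalHermitianDeformation (EndSections h))
    (hPhi : Phi h (DefStar.mk D) (DefStar.mk D')) :
    FormallyMoritaEquivalent.{w} D.Alg D'.Alg := by
  -- `Φ` supplies representatives `D₀`, `D₀'` of the two classes; the corner isomorphism and the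
  -- normalised family are built for these and then transported to `D`, `D'`.
  obtain ⟨D₀, D₀', p, Q, T, hD, hD', hT⟩ := hPhi
  obtain ⟨e⟩ := LocalHermitianDeformation.nonempty_starAlgEquiv_of_mk_eq hD
  obtain ⟨f⟩ := LocalHermitianDeformation.nonempty_starAlgEquiv_of_mk_eq hD'.symm
  obtain ⟨y, hy⟩ := Q.exists_normalised
  have hmem : ∀ k, (Q.Q.map e).mulVec (fun i => e ((y k).1 i)) = fun i => e ((y k).1 i) := fun k => by
    funext i
    have h1 := congrArg e (congrFun (y k).2 i)
    rw [← h1]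
    simp [Matrix.mulVec, dotProduct, map_sum, map_mul]
  refine ((Q.cornerIso T hT).congr e f).formallyMoritaEquivalent
    (fun k => ⟨fun i => e ((y k).1 i), hmem k⟩) ?_
  simp only [CornerIso.stdInner_map]
  rw [← map_sum, hy, map_one]
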